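/- For integers $p\le q$ let $[\![p,q]\!]$ be the set of integers $k$ with $p\le k\le q$ (empty if $q<p$), and let $\{x\}$ be the fractional part of $x$. Let $a,b,d$ be pairwise coprime positive integers with $d<\min(a,b)$ such that $d$ does not divide $ab-a-b$. Let $\langle a,b\rangle=\{xa+yb : x,y\in\mathbb N\}$ and $\langle a,b\rangle/d=\{x\in\mathbb N : dx\in\langle a,b\rangle\}$. For a numerical semigroup $S$, let $\mathrm{PF}(S)$ be the set of maximal elements of $\mathbb Z\setminus S$ for the order $x\le_S y\Leftrightarrow y-x\in S$, and let $t(S)=\#\mathrm{PF}(S)$ be the type of $S$. Let $m\in[\![1,d-1]\!]$ be such that $am+b\equiv 0 \pmod d$, and put $\alpha=\frac md$. Let $\alpha=[0,a_1,\dots,a_r,1]$ be the continued fraction expansion of $\alpha$ with positive integers $a_i$, normalized so that its last entry is $1$, put $a_0=0$, and let $p_k/q_k=[0,a_1,\dots,a_k]$ $(0\le k\le r)$ be its convergents (so $p_0=0$, $q_0=1$). Put $\delta_i=(-1)^i(q_i\alpha-p_i)$. A sequence $(e_1,\dots,e_r)$ of non-negative integers is called $\alpha$-admissible if for all $j\in[\![1,r]\!]$: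 $e_j\le a_j$, and if $e_j=0$ then either $e_i=0$ for all $i\ge j$, or $j\ge 2$ and $e_{j-1}=a_{j-1}$. The $\alpha$-numeration of a rational $\beta$ is the $\alpha$-admissible sequence $(b_1,\dots,b_r)$ such that $\beta=\sum_{j=1}^r b_j(-1)^{j-1}\delta_{j-1}$. Let $\tau=\frac{am+b}{d}$ and $\beta=1-\left\{\frac{b-1+m}{d}\right\}$. Then $\beta$ has exactly one $\alpha$-numeration $(b_1,\dots,b_r)$. Let $B=\{i\in[\![1,\lfloor r/2\rfloor]\!] : b_{2i}\ne 0\}$, let $\mu_i=\tau q_i-ap_i$ for $i\in[\![0,r]\!]$, and $$f=ab-a-b,\qquad f_1=\frac fd-a(1-\beta),\qquad f_2=\frac fd-\frac bd\sum_{i=1}^r b_iq_{i-1}.$$ Then $$\mathrm{PF}\left(\frac{\langle a,b\rangle}{d}\right)=\{f_1,f_2\}\cup\left\{\frac fd+a\beta-j\mu_{2k-1}-\sum_{i=1}^{2k-1}b_i\mu_{i-1} \;:\; j\in[\![0,b_{2k}-1]\!],\ k\in B\right\}$$ and $$t\left(\frac{\langle a,b\rangle}{d}\right)=2+\sum_{k=1}^{\lfloor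 r/2\rfloor}b_{2k}.$$ -/

import Mathlib

namespace QuotientSemigroup

/-- The submonoid `⟨a, b⟩` of `ℕ` generated by `a` and `b`. -/
def gen (a b : ℕ) : AddSubmonoid ℕ := AddSubmonoid.closure {a, b}

/-- The quotient `S / d = {x ∈ ℕ : d x ∈ S}`. -/
def quotient (S : AddSubmonoid ℕ) (d : ℕ) : AddSubmonoid ℕ where
  carrier := {x | d * x ∈ S}
  zero_mem' := by simp
  add_mem' := by
    intro x y hx hy
    simpa [mul_add] using S.add_mem hx hy

/-- `S` seen as a set of integers. -/
def toInt (S : AddSubmonoid ℕ) : Set ℤ := {x | ∃ n ∈ S, (n : ℤ) = x}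

/-- The pseudo-Frobenius numbers of `S`: the maximal elements of `ℤ \ S` for the order
`x ≤_S y ↔ y - x ∈ S`. -/
def PF (S : AddSubmonoid ℕ) : Set ℤ :=
  {x | x ∉ toInt S ∧ ∀ y : ℤ, y ∉ toInt S → y - x ∈ toInt S → y = x}

/-- The type of `S`: the number of its pseudo-Frobenius numbers. -/
noncomputable def type (S : AddSubmonoid ℕ) : ℕ := (PF S).ncard

/-- The map `F : x ↦ 1 / {x}`; its value at integers is never used. -/
def stepF (x : ℚ) : ℚ := (Int.fract x)⁻¹

/-- The `r` for which `α = [a₀, a₁, …, a_r, 1]`: the number of steps of `F` after which an integer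
is reached. Used for non-integer `α > 0`, for which `r ≥ 1`. -/
noncomputable def depth (α : ℚ) : ℕ := sInf {k : ℕ | Int.fract (stepF^[k] α) = 0}

/-- The partial quotients of the continued fraction expansion `[a₀, a₁, …, a_r, 1]` of a non-integer
rational `α > 0`. The expansion is normalized to end in `1`, so that its entry of index `r` is one
less than the last quotient `F^r(α) ≥ 2` of the Euclidean algorithm. -/
noncomputable def quot (α : ℚ) (k : ℕ) : ℕ :=
  if k < depth α then ⌊stepF^[k] α⌋₊
  else if k = depth α then ⌊stepF^[k] α⌋₊ - 1
  else if k = depth α + 1 then 1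
  else 0

/-- Numerators `p_k` of the convergents `[a₀, …, a_k]`. -/
noncomputable def convNum (α : ℚ) : ℕ → ℕ
  | 0 => quot α 0
  | 1 => quot α 1 * quot α 0 + 1
  | k + 2 => quot α (k + 2) * convNum α (k + 1) + convNum α k

/-- Denominators `q_k` of the convergents `[a₀, …, a_k]`. -/
noncomputable def convDen (α : ℚ) : ℕ → ℕ
  | 0 => 1
  | 1 => quot α 1
  | k + 2 => quot α (k + 2) * convDen α (k + 1) + convDen α k

/-- `δ_i = (-1)^i (q_i α - p_i)`. -/
noncomputable def delta (α : ℚ) (i : ℕ) : ℚ :=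
  (-1) ^ i * ((convDen α i : ℚ) * α - (convNum α i : ℚ))

/-- `α`-admissible sequences `(e₁, …, e_r)`, extended by zero outside `{1, …, r}`. -/
def Admissible (α : ℚ) (e : ℕ → ℕ) : Prop :=
  (∀ j, j ∉ Finset.Icc 1 (depth α) → e j = 0) ∧
  ∀ j ∈ Finset.Icc 1 (depth α),
    e j ≤ quot α j ∧
    (e j = 0 → (∀ i, j ≤ i → e i = 0) ∨ (2 ≤ j ∧ e (j - 1) = quot α (j - 1)))

/-- `e` is the `α`-numeration of the rational `β`: it is `α`-admissible and
`β = ∑_{j=1}^r e_j (-1)^{j-1} δ_{j-1}`. -/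
def IsNumeration (α β : ℚ) (e : ℕ → ℕ) : Prop :=
  Admissible α e ∧
  β = ∑ j ∈ Finset.Icc 1 (depth α), (e j : ℚ) * ((-1) ^ (j - 1) * delta α (j - 1))

end QuotientSemigroup

/-! ### Pseudo-Frobenius numbers as minimal points of a lattice coset. -/

namespace QuotientSemigroup

/-! Put f = ab - a - b. Since ⟨a,b⟩ is symmetric (`not_isComb_iff`), y is a gap of ⟨a,b⟩/d exactly
when f - dy = au + bv with u, v ≥ 0. Because b ≡ -am (mod d), divisibility of f - au - bv by d reads
u ≡ mv + c (mod d). Gaps thus come from the points of a coset of the lattice u ≡ mv in the first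
quadrant, and the maximal gaps from its minimal points (`mem_PF_iff`); d < min(a,b) makes the
coordinates of a minimal point unique.

The minimal points form a staircase from (c,0) to the ordinate axis, governed by the continued
fraction of m/d. With D k = dδ_{k-1} and Q k = q_{k-1}, the vectors ((-1)^(k+1) D k, Q k) lie in the
lattice and consecutive ones form a basis. Let e be the digits of T = dβ = d - c. Starting from the
coset point (-T,0), add e_k copies of the k-th vector for k = 1, 2, ...; the walk ends on the
ordinate axis. Odd digits move right, even digits move left, and the starting point of each single
left step is a minimal point. Together with (c,0) and the end of the walk these are all of them
(`minimal_iff_mem_corners`), because `le_of_lattice_vector` leaves no room between consecutive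
corners. This gives the type 2 + ∑ e_{2k}. The form au + bv takes the value dμ_{k-1} on the k-th
vector, which gives the explicit formulas (`corner_value`). -/

/-- The points `(u, v)` of the closed first quadrant with `u ≡ m v + c (mod d)`. -/
def cosetQuadrant (d m c : ℤ) : Set (ℤ × ℤ) := {P | 0 ≤ P.1 ∧ 0 ≤ P.2 ∧ d ∣ P.1 - m * P.2 - c}

/-- `n` is a combination of `a` and `b` with non-negative integer coefficients. -/
def IsComb (a b n : ℤ) : Prop := ∃ i j : ℤ, 0 ≤ i ∧ 0 ≤ j ∧ n = a * i + b * j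

theorem mem_gen_iff (a b n : ℕ) : n ∈ gen a b ↔ IsComb a b n := by
  unfold gen IsComb
  rw [AddSubmonoid.mem_closure_pair]
  constructor
  · rintro ⟨i, j, h⟩
    refine ⟨i, j, by positivity, by positivity, ?_⟩
    rw [← h]; push_cast [smul_eq_mul]; ring
  · rintro ⟨i, j, hi, hj, h⟩
    lift i to ℕ using hi
    lift j to ℕ using hj
    refine ⟨i, j, ?_⟩
    simp only [smul_eq_mul]
    have : (n : ℤ) = ((i * a + j * b : ℕ) : ℤ) := by rw [h]; push_cast; ring
    exact_mod_cast this.symm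

theorem mem_toInt_quotient_iff {a b d : ℕ} (hd : 0 < d) (z : ℤ) :
    z ∈ toInt (quotient (gen a b) d) ↔ IsComb a b (d * z) := by
  constructor
  · rintro ⟨n, hn, rfl⟩
    have := (mem_gen_iff a b (d * n)).1 hn
    exact_mod_cast this
  · intro h
    have hz : 0 ≤ z := by
      obtain ⟨i, j, hi, hj, h⟩ := h
      have h1 : 0 ≤ (d : ℤ) * z := by rw [h]; positivity
      exact nonneg_of_mul_nonneg_right h1 (by exact_mod_cast hd)
    lift z to ℕ using hz
    exact ⟨z, (mem_gen_iff a b (d * z)).2 (by exact_mod_cast h), rfl⟩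

/-- The semigroup `⟨a, b⟩` is symmetric. -/
theorem not_isComb_iff {a b : ℤ} (ha : 0 < a) (hb : 0 < b) (hab : IsCoprime a b) (n : ℤ) :
    ¬ IsComb a b n ↔ IsComb a b (a * b - a - b - n) := by
  constructor
  · intro h
    obtain ⟨s, t, hst⟩ := hab
    -- Reducing the coefficient of `a` modulo `b` gives n = ai + bj with 0 ≤ i < b. If j < 0, the
    -- pair (b-1-i, -1-j) represents ab - a - b - n.
    set i := (n * s) % b with hi
    have hi0 : 0 ≤ i := Int.emod_nonneg _ hb.ne'
    have hib : i < b := Int.emod_lt_of_pos _ hb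
    have hdiv := Int.emod_add_mul_ediv (n * s) b
    set w := (n * s) / b
    have hn : n = a * i + b * (n * t + a * w) := by
      have h1 : n * s = i + b * w := by rw [hi]; exact hdiv.symm
      linear_combination (-n) * hst + a * h1
    by_cases hj : 0 ≤ n * t + a * w
    · exact absurd ⟨i, _, hi0, hj, hn⟩ h
    · refine ⟨b - 1 - i, -1 - (n * t + a * w), by linarith, by omega, ?_⟩
      linear_combination (-1 : ℤ) * hn
  · rintro ⟨i, j, hi, hj, h⟩ ⟨i', j', hi', hj', h'⟩
    -- Adding two such representations writes ab with positive coefficients; coprimality makes the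
    -- first a multiple of b, which leaves nothing for the second.
    have key : a * (i + i' + 1) + b * (j + j' + 1) = a * b := by
      linear_combination (-1 : ℤ) * h - h'
    have h1 : b ∣ i + i' + 1 := by
      refine hab.symm.dvd_of_dvd_mul_left ⟨a - (j + j' + 1), ?_⟩
      linear_combination key
    have h2 := Int.le_of_dvd (by omega) h1
    have h3 : a * b ≤ a * (i + i' + 1) := mul_le_mul_of_nonneg_left h2 ha.le
    have h4 : 0 < b * (j + j' + 1) := mul_pos hb (by omega)
    linarith

/-- The lattice contains (d,0) and (0,d), so a coordinate ≥ d could be lowered by d. -/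
theorem minimal_lt {d m c : ℤ} (hd : 0 < d) {P : ℤ × ℤ}
    (hP : Minimal (· ∈ cosetQuadrant d m c) P) : P.1 < d ∧ P.2 < d := by
  obtain ⟨u, v⟩ := P
  obtain ⟨⟨hu, hv, hc⟩, hmin⟩ := hP
  simp only at hu hv hc
  constructor
  · by_contra! h
    simp only at h
    have := hmin (y := (u - d, v)) ⟨by simpa using h, hv, by
      simpa [sub_right_comm _ d] using hc⟩ ⟨by simpa using hd.le, le_rfl⟩
    have := this.1
    simp only at this
    linarith
  · by_contra! h
    simp only at h
    have := hmin (y := (u, v - d)) ⟨hu, by simpa using h, by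
      have e : u - m * (v - d) - c = u - m * v - c + d * m := by ring
      simp only [e]
      exact dvd_add hc (dvd_mul_right _ _)⟩ ⟨le_rfl, by simpa using hd.le⟩
    have := this.2
    simp only at this
    linarith

theorem dvd_comb_iff {a b d m c f : ℤ} (had : IsCoprime a d) (hmd : d ∣ a * m + b)
    (hc : d ∣ a * c - f) (u v : ℤ) : d ∣ f - (a * u + b * v) ↔ d ∣ u - m * v - c := by
  have e : f - (a * u + b * v) = -(a * (u - m * v - c)) - (a * m + b) * v - (a * c - f) := by ring
  rw [e, dvd_sub_left hc, dvd_sub_left (Dvd.dvd.mul_right hmd _), dvd_neg]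
  exact ⟨fun h => had.symm.dvd_of_dvd_mul_left h, fun h => Dvd.dvd.mul_left h _⟩

/-- Combinations with small coefficients are unique. -/
theorem comb_unique {a b u v u' v' : ℤ} (ha : 0 < a) (hb : 0 < b) (hab : IsCoprime a b)
    (hu : u < b) (hv : v < a) (hu' : 0 ≤ u') (hv' : 0 ≤ v')
    (h : a * u + b * v = a * u' + b * v') : u = u' ∧ v = v' := by
  obtain ⟨k, hk⟩ : b ∣ u' - u :=
    hab.symm.dvd_of_dvd_mul_left ⟨v - v', by linear_combination (-1 : ℤ) * h⟩
  have hk2 : v - v' = a * k := by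
    have : b * (v - v') = b * (a * k) := by linear_combination h + a * hk
    exact mul_left_cancel₀ hb.ne' this
  have hk0 : k = 0 := by
    rcases lt_trichotomy k 0 with hk' | hk' | hk'
    · nlinarith
    · exact hk'
    · nlinarith
  subst hk0
  constructor <;> linarith

/-- The pseudo-Frobenius numbers of `⟨a, b⟩ / d` correspond to the minimal points of a coset of a
planar lattice in the first quadrant. -/
theorem mem_PF_iff {a b d : ℕ} (ha : 0 < a) (hb : 0 < b) (hd : 0 < d)
    (hab : Nat.Coprime a b) (had : Nat.Coprime a d) (hda : d < a) (hdb : d < b)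
    {m c : ℤ} (hmd : (d : ℤ) ∣ a * m + b) (hc : (d : ℤ) ∣ a * c - (a * b - a - b)) (x : ℤ) :
    x ∈ PF (quotient (gen a b) d) ↔
      ∃ P : ℤ × ℤ, Minimal (· ∈ cosetQuadrant d m c) P ∧
        (d : ℤ) * x = (a * b - a - b) - (a * P.1 + b * P.2) := by
  have ha' : (0 : ℤ) < a := by exact_mod_cast ha
  have hb' : (0 : ℤ) < b := by exact_mod_cast hb
  have hd' : (0 : ℤ) < d := by exact_mod_cast hd
  have hda' : (d : ℤ) < a := by exact_mod_cast hda
  have hdb' : (d : ℤ) < b := by exact_mod_cast hdb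
  have hab' : IsCoprime (a : ℤ) b := Nat.isCoprime_iff_coprime.2 hab
  have had' : IsCoprime (a : ℤ) d := Nat.isCoprime_iff_coprime.2 had
  have hnot : ∀ y : ℤ, y ∉ toInt (quotient (gen a b) d) ↔
      IsComb a b (a * b - a - b - d * y) := fun y => by
    rw [mem_toInt_quotient_iff hd, not_isComb_iff ha' hb' hab']
  have hmem : x ∈ PF (quotient (gen a b) d) ↔ IsComb a b (a * b - a - b - d * x) ∧
      ∀ y : ℤ, IsComb a b (a * b - a - b - d * y) → IsComb a b (d * (y - x)) → y = x := by
    simp only [← hnot, ← mem_toInt_quotient_iff hd]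
    rfl
  rw [hmem]
  constructor
  · rintro ⟨⟨u, v, hu, hv, h⟩, hmax⟩
    have hC : (d : ℤ) ∣ u - m * v - c :=
      (dvd_comb_iff had' hmd hc u v).1 ⟨x, by linear_combination h⟩
    refine ⟨(u, v), ⟨⟨hu, hv, hC⟩, ?_⟩, by linear_combination (-1 : ℤ) * h⟩
    rintro ⟨u', v'⟩ ⟨hu', hv', hC'⟩ ⟨hle1, hle2⟩
    simp only at hu' hv' hC' hle1 hle2
    obtain ⟨y, hy⟩ := (dvd_comb_iff had' hmd hc u' v').2 hC'
    -- A smaller coset point gives a gap y with d(y-x) = a(u-u') + b(v-v'), so y lies above x in the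
    -- semigroup order.
    have hyx : y = x := by
      refine hmax y ⟨u', v', hu', hv', by linear_combination hy⟩
        ⟨u - u', v - v', by linarith, by linarith, by linear_combination h - hy⟩
    subst hyx
    have e : (a : ℤ) * (u - u') + b * (v - v') = 0 := by linear_combination hy - h
    have h1 : 0 ≤ (a : ℤ) * (u - u') := mul_nonneg ha'.le (by linarith)
    have h2 : 0 ≤ (b : ℤ) * (v - v') := mul_nonneg hb'.le (by linarith)
    have h3 : u - u' = 0 := (mul_eq_zero.1 (show (a : ℤ) * (u - u') = 0 by linarith)).resolve_left
      ha'.ne'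
    have h4 : v - v' = 0 := (mul_eq_zero.1 (show (b : ℤ) * (v - v') = 0 by linarith)).resolve_left
      hb'.ne'
    exact ⟨by simp only; linarith, by simp only; linarith⟩
  · rintro ⟨⟨u, v⟩, hP, hx⟩
    obtain ⟨hud, hvd⟩ := minimal_lt hd' hP
    obtain ⟨⟨hu, hv, hC⟩, hmin⟩ := hP
    simp only at hud hvd hu hv hC hx
    refine ⟨⟨u, v, hu, hv, by linear_combination (-1 : ℤ) * hx⟩, ?_⟩
    rintro y ⟨u', v', hu', hv', hy⟩ ⟨i, j, hi, hj, hij⟩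
    -- The coordinates of the minimal point are below d < min(a,b), so (u,v) = (u'+i, v'+j), and
    -- minimality then forces i = j = 0.
    obtain ⟨h1, h2⟩ := comb_unique (u := u) (v := v) (u' := u' + i) (v' := v' + j) ha' hb' hab'
      (by linarith) (by linarith) (by linarith) (by linarith)
      (by linear_combination hy + hij + hx)
    have hle := hmin (y := (u', v')) ⟨hu', hv',
      (dvd_comb_iff had' hmd hc u' v').1 ⟨y, by linear_combination hy⟩⟩
      ⟨by simp only; linarith, by simp only; linarith⟩
    have h3 := hle.1
    have h4 := hle.2
    simp only at h3 h4
    have hi0 : i = 0 := by linarith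
    have hj0 : j = 0 := by linarith
    subst hi0 hj0
    have : (d : ℤ) * (y - x) = 0 := by rw [hij]; ring
    linarith [(mul_eq_zero.1 this).resolve_left hd'.ne']

end QuotientSemigroup

/-! ### Numeration of integers in [0, d) along a continued fraction. -/

namespace QuotientSemigroup

/-- The data of the normalized continued fraction expansion of `m / d`: partial quotients
`A 1, …, A r`, scaled errors `D` and denominators `Q`, with indices of `D` and `Q` shifted by one. -/
structure IsExpansion (d m : ℤ) (r : ℕ) (A : ℕ → ℕ) (D Q : ℕ → ℤ) : Prop where
  quot_pos : ∀ k < r, 1 ≤ A (k + 1)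
  err_zero : D 0 = d
  err_one : D 1 = m
  err_rec : ∀ k < r, D k = A (k + 1) * D (k + 1) + D (k + 2)
  err_pos : ∀ k ≤ r + 1, 0 < D k
  -- The last two errors both equal 1 because the expansion is normalized to end in 1 and m, d are
  -- coprime.
  err_depth : D r = 1
  err_last : D (r + 1) = 1
  den_zero : Q 0 = 0
  den_one : Q 1 = 1
  den_rec : ∀ k < r, Q (k + 2) = A (k + 1) * Q (k + 1) + Q k

/-- Admissible digit sequences with respect to the partial quotients `A 1, …, A r`. -/
def IsAdmissible (r : ℕ) (A e : ℕ → ℕ) : Prop :=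
  (∀ j, j ∉ Finset.Icc 1 r → e j = 0) ∧
  ∀ j ∈ Finset.Icc 1 r,
    e j ≤ A j ∧ (e j = 0 → (∀ i, j ≤ i → e i = 0) ∨ (2 ≤ j ∧ e (j - 1) = A (j - 1)))

/-- The signed remainder of `T` after its first `i` digits. -/
def tail (D : ℕ → ℤ) (e : ℕ → ℕ) (T : ℤ) (i : ℕ) : ℤ :=
  (-1) ^ i * (T - ∑ l ∈ Finset.Icc 1 i, (-1) ^ (l - 1) * (e l * D l))

/-- The sum of the first `i` digits weighted by the denominators. -/
def weight (Q : ℕ → ℤ) (e : ℕ → ℕ) (i : ℕ) : ℤ := ∑ l ∈ Finset.Icc 1 i, e l * Q l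

@[simp] theorem tail_zero (D : ℕ → ℤ) (e : ℕ → ℕ) (T : ℤ) : tail D e T 0 = T := by simp [tail]

theorem tail_succ (D : ℕ → ℤ) (e : ℕ → ℕ) (T : ℤ) (i : ℕ) :
    tail D e T (i + 1) = e (i + 1) * D (i + 1) - tail D e T i := by
  have h : ((-1 : ℤ) ^ i) * (-1) ^ i = 1 := by rw [← mul_pow]; simp
  simp only [tail, Finset.sum_Icc_succ_top (Nat.le_add_left 1 i), Nat.add_sub_cancel, pow_succ]
  linear_combination (e (i + 1) * D (i + 1) : ℤ) * h

@[simp] theorem weight_zero (Q : ℕ → ℤ) (e : ℕ → ℕ) : weight Q e 0 = 0 := by simp [weight]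

theorem weight_succ (Q : ℕ → ℤ) (e : ℕ → ℕ) (i : ℕ) :
    weight Q e (i + 1) = weight Q e i + e (i + 1) * Q (i + 1) := by
  simp only [weight, Finset.sum_Icc_succ_top (Nat.le_add_left 1 i)]

theorem tail_depth_eq_zero_iff (D : ℕ → ℤ) (e : ℕ → ℕ) (T : ℤ) (r : ℕ) :
    tail D e T r = 0 ↔ T = ∑ l ∈ Finset.Icc 1 r, (-1) ^ (l - 1) * (e l * D l) := by
  simp [tail, sub_eq_zero]

namespace IsExpansion

variable {d m : ℤ} {r : ℕ} {A : ℕ → ℕ} {D Q : ℕ → ℤ}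

/-- Consecutive vectors ((-1)^(k+1) D k, Q k) have determinant ±d, the index of the lattice u ≡ mv
(mod d), hence form a basis. -/
theorem det (h : IsExpansion d m r A D Q) : ∀ k ≤ r, D k * Q (k + 1) + D (k + 1) * Q k = d := by
  intro k
  induction k with
  | zero => intro _; simp [h.den_one, h.den_zero, h.err_zero]
  | succ k ih =>
    intro hk
    have := ih (by omega)
    have h1 := h.err_rec k (by omega)
    have h2 := h.den_rec k (by omega)
    rw [h2]
    rw [h1] at this
    linear_combination this

theorem dvd_err_add (h : IsExpansion d m r A D Q) :
    ∀ k ≤ r + 1, d ∣ (-1) ^ k * D k + m * Q k := by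
  intro k
  induction k using Nat.strong_induction_on with
  | _ k ih =>
    intro hk
    match k, ih, hk with
    | 0, _, _ => simp [h.err_zero, h.den_zero]
    | 1, _, _ => simp [h.err_one, h.den_one]
    | k + 2, ih, hk =>
      have h1 := h.err_rec k (by omega)
      have h2 := h.den_rec k (by omega)
      have e : (-1) ^ (k + 2) * D (k + 2) + m * Q (k + 2) = ((-1) ^ k * D k + m * Q k) +
          ((-1) ^ (k + 1) * D (k + 1) + m * Q (k + 1)) * A (k + 1) := by
        rw [h2, h1]; ring
      rw [e]
      exact dvd_add (ih k (by omega) (by omega)) (Dvd.dvd.mul_right (ih (k + 1) (by omega)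
        (by omega)) _)

theorem den_pos (h : IsExpansion d m r A D Q) : ∀ k ≤ r, 0 ≤ Q k ∧ 0 < Q (k + 1) := by
  intro k
  induction k with
  | zero => intro _; simp [h.den_one, h.den_zero]
  | succ k ih =>
    intro hk
    have ⟨h1, h2⟩ := ih (by omega)
    have h3 : (1 : ℤ) ≤ A (k + 1) := by exact_mod_cast h.quot_pos k (by omega)
    rw [h.den_rec k (by omega)]
    refine ⟨h2.le, by positivity⟩

theorem den_nonneg (h : IsExpansion d m r A D Q) {k : ℕ} (hk : k ≤ r + 1) : 0 ≤ Q k := by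
  rcases k with _ | k
  · rw [h.den_zero]
  · exact (h.den_pos k (by omega)).2.le

end IsExpansion

section Numeration

variable {d m : ℤ} {r : ℕ} {A : ℕ → ℕ} {D Q : ℕ → ℤ} {e : ℕ → ℕ} {T : ℤ}

theorem tail_eq_zero_of_forall_eq_zero (hT : tail D e T r = 0) :
    ∀ n i, i + n = r → (∀ l, i < l → e l = 0) → tail D e T i = 0 := by
  intro n
  induction n with
  | zero => rintro i hi _; rwa [show i = r by omega]
  | succ n ih =>
    intro i hi h0
    have h1 := ih (i + 1) (by omega) (fun l hl => h0 l (by omega))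
    rw [tail_succ, h0 (i + 1) (by omega)] at h1
    simpa using h1

/-- Downward induction from r. By admissibility a remainder can be negative only after a full digit.
If the next remainder is ≥ 0, the upper bound follows from e(i+1) ≤ A(i+1); if the digit is full, it
follows from D i = A(i+1) D(i+1) + D(i+2). -/
theorem tail_bounds (h : IsExpansion d m r A D Q) (he : IsAdmissible r A e)
    (hT : tail D e T r = 0) :
    ∀ n i, i + n = r → tail D e T i < D i ∧ -D (i + 1) < tail D e T i ∧
      (1 ≤ e (i + 1) → 0 ≤ tail D e T i) := by
  intro n
  induction n with
  | zero =>
    rintro i hi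
    rw [show i = r by omega, hT, h.err_depth, h.err_last]
    simp
  | succ n ih =>
    intro i hi
    obtain ⟨h1, h2, h3⟩ := ih (i + 1) (by omega)
    have hrec := h.err_rec i (by omega)
    have hs := tail_succ D e T i
    have hadm := he.2 (i + 1) (by simp; omega)
    have hD1 := h.err_pos (i + 1) (by omega)
    have hD2 := h.err_pos (i + 2) (by omega)
    have hpos : 1 ≤ e (i + 1) → 0 ≤ tail D e T i := by
      intro h1e
      have : D (i + 1) ≤ e (i + 1) * D (i + 1) :=
        le_mul_of_one_le_left hD1.le (by exact_mod_cast h1e)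
      linarith
    have hzero : 0 ≤ tail D e T (i + 1) ∨ e (i + 1) = A (i + 1) := by
      by_cases hlast : i + 1 = r
      · left; rw [hlast, hT]
      by_cases h0 : e (i + 2) = 0
      · rcases (he.2 (i + 2) (by simp; omega)).2 h0 with h4 | h4
        · left
          exact (tail_eq_zero_of_forall_eq_zero hT n (i + 1) (by omega)
            (fun l hl => h4 l (by omega))).ge
        · right; exact h4.2
      · left; exact h3 (Nat.one_le_iff_ne_zero.2 h0)
    refine ⟨?_, ?_, hpos⟩
    · rcases hzero with h4 | h4
      · have : (e (i + 1) : ℤ) * D (i + 1) ≤ A (i + 1) * D (i + 1) :=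
          mul_le_mul_of_nonneg_right (by exact_mod_cast hadm.1) hD1.le
        linarith
      · rw [h4] at hs
        linarith
    · by_cases h0 : e (i + 1) = 0
      · rw [h0] at hs
        push_cast at hs
        linarith
      · have := hpos (by omega)
        linarith

theorem tail_lt (h : IsExpansion d m r A D Q) (he : IsAdmissible r A e)
    (hT : tail D e T r = 0) {i : ℕ} (hi : i ≤ r) : tail D e T i < D i :=
  (tail_bounds h he hT (r - i) i (by omega)).1

theorem digit_succ_eq_zero_of_tail_neg (h : IsExpansion d m r A D Q) (he : IsAdmissible r A e)
    (hT : tail D e T r = 0) {i : ℕ} (hi : i ≤ r) (hneg : tail D e T i < 0) : e (i + 1) = 0 := by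
  by_contra h0
  have := (tail_bounds h he hT (r - i) i (by omega)).2.2 (by omega)
  omega

theorem digit_eq_quot_of_tail_neg (h : IsExpansion d m r A D Q) (he : IsAdmissible r A e)
    (hT : tail D e T r = 0) {i : ℕ} (hi : i ≤ r) (hneg : tail D e T i < 0) :
    1 ≤ i ∧ e i = A i := by
  have h0 := digit_succ_eq_zero_of_tail_neg h he hT hi hneg
  have hir : i ≠ r := by rintro rfl; omega
  rcases (he.2 (i + 1) (by simp; omega)).2 h0 with h1 | h1
  · have := tail_eq_zero_of_forall_eq_zero hT (r - i) i (by omega) (fun l hl => h1 l (by omega))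
    omega
  · exact ⟨by omega, h1.2⟩

/-- A smaller digit of e would leave e a negative remainder; its digit would then be full, hence not
smaller. -/
theorem digit_le_of_tail_eq (h : IsExpansion d m r A D Q) {e' : ℕ → ℕ}
    (he : IsAdmissible r A e) (hT : tail D e T r = 0)
    (he' : IsAdmissible r A e') (hT' : tail D e' T r = 0) {i : ℕ} (hi : i < r)
    (heq : tail D e T i = tail D e' T i) : e' (i + 1) ≤ e (i + 1) := by
  by_contra! hlt
  have hs := tail_succ D e T i
  have hs' := tail_succ D e' T i
  have hD := h.err_pos (i + 1) (by omega)
  have h1 : (e (i + 1) + 1 : ℤ) * D (i + 1) ≤ e' (i + 1) * D (i + 1) :=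
    mul_le_mul_of_nonneg_right (by exact_mod_cast hlt) hD.le
  have h2 := tail_lt h he' hT' (i := i + 1) (by omega)
  have h3 := (digit_eq_quot_of_tail_neg h he hT (i := i + 1) (by omega) (by linarith)).2
  have h4 := (he'.2 (i + 1) (by simp; omega)).1
  omega

/-- An integer has at most one admissible digit sequence. -/
theorem digits_unique (h : IsExpansion d m r A D Q) {e' : ℕ → ℕ}
    (he : IsAdmissible r A e) (hT : tail D e T r = 0)
    (he' : IsAdmissible r A e') (hT' : tail D e' T r = 0) : e = e' := by
  have key : ∀ i ≤ r, tail D e T i = tail D e' T i := by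
    intro i
    induction i with
    | zero => simp
    | succ i ih =>
      intro hi
      have heq := ih (by omega)
      rw [tail_succ, tail_succ, heq, le_antisymm
        (digit_le_of_tail_eq h he' hT' he hT (by omega) heq.symm)
        (digit_le_of_tail_eq h he hT he' hT' (by omega) heq)]
  funext j
  by_cases hj : j ∈ Finset.Icc 1 r
  · obtain ⟨i, rfl⟩ : ∃ i, j = i + 1 := ⟨j - 1, by simp at hj; omega⟩
    have hi : i < r := by simp at hj; omega
    exact le_antisymm (digit_le_of_tail_eq h he' hT' he hT hi (key i hi.le).symm)
      (digit_le_of_tail_eq h he hT he' hT' hi (key i hi.le))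
  · rw [he.1 j hj, he'.1 j hj]

/-- The digit of index `i + 1` chosen for the remainder `x`. -/
def greedyDigit (A : ℕ → ℕ) (D : ℕ → ℤ) (i : ℕ) (x : ℤ) : ℕ :=
  -- `-(-x / D)` is the ceiling of x/D: the digit overshoots, so the next remainder is negative only
  -- when the cap `A (i + 1)` intervenes.
  if x < 0 then 0 else min (-(-x / D (i + 1))).toNat (A (i + 1))

/-- The successive remainders of the greedy expansion of `T`. -/
def greedyTail (A : ℕ → ℕ) (D : ℕ → ℤ) (T : ℤ) : ℕ → ℤ
  | 0 => T
  | i + 1 => greedyDigit A D i (greedyTail A D T i) * D (i + 1) - greedyTail A D T i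

/-- The digits of the greedy expansion of `T`. -/
def greedy (r : ℕ) (A : ℕ → ℕ) (D : ℕ → ℤ) (T : ℤ) (j : ℕ) : ℕ :=
  if j ∈ Finset.Icc 1 r then greedyDigit A D (j - 1) (greedyTail A D T (j - 1)) else 0

theorem greedyDigit_le (A : ℕ → ℕ) (D : ℕ → ℤ) (i : ℕ) (x : ℤ) :
    greedyDigit A D i x ≤ A (i + 1) := by
  unfold greedyDigit
  split_ifs
  · exact Nat.zero_le _
  · exact min_le_right _ _

theorem greedyDigit_pos {i : ℕ} {x : ℤ} (hA : 1 ≤ A (i + 1)) (hD : 0 < D (i + 1)) (hx : 0 < x) :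
    1 ≤ greedyDigit A D i x := by
  unfold greedyDigit
  rw [if_neg (by omega)]
  have : -x / D (i + 1) < 0 := Int.ediv_neg_of_neg_of_pos (by omega) hD
  omega

theorem greedyDigit_zero (A : ℕ → ℕ) (D : ℕ → ℤ) (i : ℕ) : greedyDigit A D i 0 = 0 := by
  simp [greedyDigit]

theorem greedy_step {i : ℕ} {x : ℤ} (hD1 : 0 < D (i + 1)) (hD2 : 0 < D (i + 2))
    (hrec : D i = A (i + 1) * D (i + 1) + D (i + 2)) (h1 : -D (i + 1) < x) (h2 : x < D i) :
    -D (i + 2) < greedyDigit A D i x * D (i + 1) - x ∧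
      greedyDigit A D i x * D (i + 1) - x < D (i + 1) ∧
      (greedyDigit A D i x * D (i + 1) - x < 0 → greedyDigit A D i x = A (i + 1)) := by
  by_cases hx : x < 0
  · have h0 : greedyDigit A D i x = 0 := by simp [greedyDigit, hx]
    rw [h0]
    push_cast
    refine ⟨by linarith, by linarith, fun h => by linarith⟩
  · have hdiv := Int.emod_add_mul_ediv (-x) (D (i + 1))
    have hm0 := Int.emod_nonneg (-x) hD1.ne'
    have hm1 := Int.emod_lt_of_pos (-x) hD1
    have hle : -x / D (i + 1) ≤ 0 := by
      simpa using Int.ediv_le_ediv hD1 (show -x ≤ 0 by omega)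
    have hdig : greedyDigit A D i x = min (-(-x / D (i + 1))).toNat (A (i + 1)) := by
      simp [greedyDigit, hx]
    rw [hdig]
    generalize hq : -x / D (i + 1) = q at *
    obtain ⟨c, rfl⟩ : ∃ c : ℕ, q = -(c : ℤ) := ⟨(-q).toNat, by omega⟩
    simp only [neg_neg, Int.toNat_natCast]
    rcases le_or_gt c (A (i + 1)) with hc | hc
    · rw [min_eq_left hc]
      have e1 : (c : ℤ) * D (i + 1) - x = -x % D (i + 1) := by linear_combination -hdiv
      rw [e1]
      exact ⟨by linarith, hm1, fun h => by linarith⟩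
    · rw [min_eq_right hc.le]
      have hc' : (A (i + 1) + 1 : ℤ) * D (i + 1) ≤ c * D (i + 1) :=
        mul_le_mul_of_nonneg_right (by exact_mod_cast hc) hD1.le
      refine ⟨by linarith, by linarith, fun _ => rfl⟩

theorem greedyTail_bounds (h : IsExpansion d m r A D Q) (hT0 : 0 ≤ T) (hTd : T < d) :
    ∀ i ≤ r, -D (i + 1) < greedyTail A D T i ∧ greedyTail A D T i < D i ∧
      (greedyTail A D T i < 0 → 1 ≤ i ∧ greedy r A D T i = A i) := by
  intro i
  induction i with
  | zero =>
    intro _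
    have := h.err_pos 1 (by omega)
    simp only [greedyTail, h.err_zero, zero_add]
    exact ⟨by linarith, hTd, fun h => by linarith⟩
  | succ i ih =>
    intro hi
    obtain ⟨h1, h2, -⟩ := ih (by omega)
    obtain ⟨h3, h4, h5⟩ := greedy_step (h.err_pos (i + 1) (by omega))
      (h.err_pos (i + 2) (by omega)) (h.err_rec i (by omega)) h1 h2
    refine ⟨h3, h4, fun h6 => ⟨by omega, ?_⟩⟩
    simp only [greedy, Nat.add_sub_cancel]
    rw [if_pos (by simp; omega)]
    exact h5 h6

theorem greedyTail_eq_zero {i : ℕ} (h0 : greedyTail A D T i = 0) (n : ℕ) :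
    greedyTail A D T (i + n) = 0 := by
  induction n with
  | zero => exact h0
  | succ n ih => simp [greedyTail, ih, greedyDigit_zero]

theorem greedy_isAdmissible (h : IsExpansion d m r A D Q) (hT0 : 0 ≤ T) (hTd : T < d) :
    IsAdmissible r A (greedy r A D T) := by
  refine ⟨fun j hj => by simp only [greedy, if_neg hj], fun j hj => ?_⟩
  obtain ⟨i, rfl⟩ : ∃ i, j = i + 1 := ⟨j - 1, by simp at hj; omega⟩
  have hi : i < r := by simp at hj; omega
  have hdig : greedy r A D T (i + 1) = greedyDigit A D i (greedyTail A D T i) := by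
    simp only [greedy, if_pos hj, Nat.add_sub_cancel]
  refine ⟨hdig ▸ greedyDigit_le A D i _, fun h0 => ?_⟩
  rcases lt_trichotomy (greedyTail A D T i) 0 with h1 | h1 | h1
  · obtain ⟨h2, h3⟩ := (greedyTail_bounds h hT0 hTd i hi.le).2.2 h1
    exact Or.inr ⟨by omega, h3⟩
  · left
    intro l hl
    obtain ⟨n, rfl⟩ : ∃ n, l = i + n + 1 := ⟨l - i - 1, by omega⟩
    simp only [greedy, Nat.add_sub_cancel, greedyTail_eq_zero h1 n, greedyDigit_zero, ite_self]
  · have := greedyDigit_pos (h.quot_pos i hi) (h.err_pos (i + 1) (by omega)) h1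
    omega

theorem tail_greedy : ∀ i ≤ r, tail D (greedy r A D T) T i = greedyTail A D T i := by
  intro i
  induction i with
  | zero => simp [greedyTail]
  | succ i ih =>
    intro hi
    rw [tail_succ, ih (by omega)]
    simp only [greedyTail, greedy, Nat.add_sub_cancel]
    rw [if_pos (by simp; omega)]

/-- Every integer in `[0, d)` has an admissible digit sequence. -/
theorem exists_digits (h : IsExpansion d m r A D Q) (hT0 : 0 ≤ T) (hTd : T < d) :
    ∃ e, IsAdmissible r A e ∧ tail D e T r = 0 := by
  refine ⟨_, greedy_isAdmissible h hT0 hTd, ?_⟩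
  rw [tail_greedy r le_rfl]
  -- The last two errors being 1, the final remainder lies strictly between -1 and 1.
  obtain ⟨h1, h2, -⟩ := greedyTail_bounds h hT0 hTd r le_rfl
  rw [h.err_last] at h1
  rw [h.err_depth] at h2
  omega

end Numeration

end QuotientSemigroup

/-! ### The staircase of minimal points. -/

namespace QuotientSemigroup

/-- If `(-s, t)` and `(g, q)` span the lattice `u ≡ m v (mod d)`, then `t` is the smallest ordinate
of a lattice vector `(-x, y)` with `0 < x < s + g` and `y ≥ 0`. -/
theorem le_of_lattice_vector {d m s t g q x y : ℤ} (hd : 0 < d) (hT : d ∣ s + m * t)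
    (hV : d ∣ g - m * q) (hdet : g * t + s * q = d) (hs : 0 < s) (ht : 0 ≤ t) (hg : 0 < g)
    (hq : 0 < q) (hL : d ∣ x + m * y) (hx0 : 0 < x) (hx : x < s + g) (hy : 0 ≤ y) : t ≤ y := by
  -- Cramer's rule, with determinant `hdet`, gives (-x,y) = j(-s,t) + i(g,q). The signs of x and y
  -- force j ≥ 1, and x < s + g then forces i ≥ 0, so y ≥ t.
  obtain ⟨i, hi⟩ : d ∣ s * y - x * t := by
    have e : s * y - x * t = (s + m * t) * y - (x + m * y) * t := by ring
    rw [e]; exact dvd_sub (hT.mul_right _) (hL.mul_right _)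
  obtain ⟨j, hj⟩ : d ∣ g * y + x * q := by
    have e : g * y + x * q = (g - m * q) * y + (x + m * y) * q := by ring
    rw [e]; exact dvd_add (hV.mul_right _) (hL.mul_right _)
  have e1 : i * g - j * s = -x := by
    apply mul_left_cancel₀ hd.ne'
    linear_combination (-g) * hi + s * hj - x * hdet
  have e2 : i * q + j * t = y := by
    apply mul_left_cancel₀ hd.ne'
    linear_combination (-q) * hi - t * hj + y * hdet
  have hj1 : 1 ≤ j := by
    by_contra! hj0
    have hjs : j * s ≤ 0 := mul_nonpos_of_nonpos_of_nonneg (by omega) hs.le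
    have hi0 : i < 0 := by
      by_contra! hi0
      have := mul_nonneg hi0 hg.le
      linarith
    have h1 : i * q < 0 := mul_neg_of_neg_of_pos hi0 hq
    have h2 : j * t ≤ 0 := mul_nonpos_of_nonpos_of_nonneg (by omega) ht
    linarith
  have hi0 : 0 ≤ i := by
    by_contra! hi0
    have h1 : i * g ≤ -1 * g := mul_le_mul_of_nonneg_right (by omega) hg.le
    have h2 : 1 * s ≤ j * s := mul_le_mul_of_nonneg_right hj1 hs.le
    linarith
  have h1 : 0 ≤ i * q := mul_nonneg hi0 hq.le
  have h2 : 1 * t ≤ j * t := mul_le_mul_of_nonneg_right hj1 ht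
  linarith

/-- The intermediate corners. -/
def corner (D Q : ℕ → ℤ) (e : ℕ → ℕ) (T : ℤ) (k j : ℕ) : ℤ × ℤ :=
  (tail D e T (2 * k + 1) - j * D (2 * k + 2), weight Q e (2 * k + 1) + j * Q (2 * k + 2))

/-- The set of points that will be shown to be the minimal ones. -/
def corners (r : ℕ) (D Q : ℕ → ℤ) (e : ℕ → ℕ) (T c : ℤ) : Set (ℤ × ℤ) :=
  {P | P = (c, 0) ∨ P = (0, weight Q e r) ∨ ∃ k j, j < e (2 * k + 2) ∧ P = corner D Q e T k j}

section Corners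

variable {d m c : ℤ} {r : ℕ} {A : ℕ → ℕ} {D Q : ℕ → ℤ} {e : ℕ → ℕ} {T : ℤ}

theorem IsExpansion.pos (h : IsExpansion d m r A D Q) : 0 < d := by
  rw [← h.err_zero]; exact h.err_pos 0 (by omega)

/-- The walk from (-T,0) stays in the coset: after i digits it is at ((-1)^(i+1) `tail` i, `weight`
i). -/
theorem dvd_tail_add_weight (h : IsExpansion d m r A D Q) (hc : T + c = d) :
    ∀ i ≤ r + 1, d ∣ (-1) ^ i * tail D e T i + m * weight Q e i + c := by
  intro i
  induction i with
  | zero => intro _; simp [hc]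
  | succ i ih =>
    intro hi
    have e1 : (-1) ^ (i + 1) * tail D e T (i + 1) + m * weight Q e (i + 1) + c =
        ((-1) ^ i * tail D e T i + m * weight Q e i + c) +
          ((-1) ^ (i + 1) * D (i + 1) + m * Q (i + 1)) * e (i + 1) := by
      rw [tail_succ, weight_succ]; ring
    rw [e1]
    exact dvd_add (ih (by omega)) ((h.dvd_err_add (i + 1) hi).mul_right _)

theorem dvd_err_even (h : IsExpansion d m r A D Q) {k : ℕ} (hk : 2 * k ≤ r + 1) :
    d ∣ D (2 * k) + m * Q (2 * k) := by
  simpa [pow_mul] using h.dvd_err_add (2 * k) hk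

theorem dvd_err_odd (h : IsExpansion d m r A D Q) {k : ℕ} (hk : 2 * k ≤ r) :
    d ∣ D (2 * k + 1) - m * Q (2 * k + 1) := by
  have := h.dvd_err_add (2 * k + 1) (by omega)
  have e1 : D (2 * k + 1) - m * Q (2 * k + 1) =
      -((-1) ^ (2 * k + 1) * D (2 * k + 1) + m * Q (2 * k + 1)) := by
    simp only [pow_succ, pow_mul]; ring
  rw [e1]
  exact (dvd_neg).2 this

theorem digit_le (he : IsAdmissible r A e) {i : ℕ} (hi : i < r) : e (i + 1) ≤ A (i + 1) :=
  (he.2 (i + 1) (by simp; omega)).1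

theorem le_depth_of_digit_ne_zero (he : IsAdmissible r A e) {i : ℕ} (hi : e i ≠ 0) : i ≤ r := by
  by_contra! hlt
  exact hi (he.1 i (by simp; omega))

theorem digit_mul_err_lt (h : IsExpansion d m r A D Q) (he : IsAdmissible r A e) {i : ℕ}
    (hi : i ≤ r) : 0 < D i - e (i + 1) * D (i + 1) := by
  rcases hi.lt_or_eq with hi | rfl
  · have h1 : (e (i + 1) : ℤ) * D (i + 1) ≤ A (i + 1) * D (i + 1) :=
      mul_le_mul_of_nonneg_right (by exact_mod_cast digit_le he hi) (h.err_pos _ (by omega)).le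
    have h2 := h.err_rec i hi
    have h3 := h.err_pos (i + 2) (by omega)
    linarith
  · rw [he.1 (i + 1) (by simp), h.err_depth]; simp

theorem tail_succ_lt (h : IsExpansion d m r A D Q) (he : IsAdmissible r A e)
    (hT : tail D e T r = 0) {i : ℕ} (hi : i ≤ r) : tail D e T (i + 1) < D (i + 1) := by
  rcases hi.lt_or_eq with hi | rfl
  · exact tail_lt h he hT hi
  · rw [tail_succ, hT, he.1 (i + 1) (by simp), h.err_last]; simp

/-- Points beyond the last corner of a block lie above the level of the next block. -/
theorem weight_le_of_lt (h : IsExpansion d m r A D Q) (he : IsAdmissible r A e)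
    (hT : tail D e T r = 0) (hc : T + c = d) {k : ℕ} (hk : 2 * k ≤ r) {x y : ℤ}
    (hP : (x, y) ∈ cosetQuadrant d m c) (hx : x < D (2 * k) - tail D e T (2 * k))
    (hy : weight Q e (2 * k) - Q (2 * k) ≤ y) : weight Q e (2 * k + 1) ≤ y := by
  obtain ⟨hx0, hy0, hC⟩ := hP
  simp only at hx0 hy0 hC
  have hQ := h.den_pos (2 * k) hk
  have hrec := tail_succ D e T (2 * k)
  -- Seen from the block end (D(2k) - tail(2k), weight(2k) - Q(2k)), the vector (-s,t) leads to the
  -- walk's position after 2k+1 digits.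
  have key := le_of_lattice_vector (d := d) (m := m) (s := D (2 * k) - e (2 * k + 1) * D (2 * k + 1))
    (t := Q (2 * k) + e (2 * k + 1) * Q (2 * k + 1)) (g := D (2 * k + 1)) (q := Q (2 * k + 1))
    (x := D (2 * k) - tail D e T (2 * k) - x) (y := y - (weight Q e (2 * k) - Q (2 * k)))
    h.pos ?_ (dvd_err_odd h hk) ?_ (digit_mul_err_lt h he hk)
    (add_nonneg hQ.1 (mul_nonneg (by positivity) hQ.2.le)) (h.err_pos _ (by omega)) hQ.2 ?_
    (by linarith) ?_ (by linarith)
  · rw [weight_succ]; linarith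
  · have e1 : D (2 * k) - e (2 * k + 1) * D (2 * k + 1) +
        m * (Q (2 * k) + e (2 * k + 1) * Q (2 * k + 1)) = (D (2 * k) + m * Q (2 * k)) -
        (D (2 * k + 1) - m * Q (2 * k + 1)) * e (2 * k + 1) := by ring
    rw [e1]
    exact dvd_sub (dvd_err_even h (by omega)) ((dvd_err_odd h hk).mul_right _)
  · linear_combination h.det (2 * k) hk
  · have h1 : d ∣ tail D e T (2 * k) + m * weight Q e (2 * k) + c := by
      simpa [pow_mul] using dvd_tail_add_weight (e := e) h hc (2 * k) (by omega)
    have e1 : D (2 * k) - tail D e T (2 * k) - x + m * (y - (weight Q e (2 * k) - Q (2 * k))) =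
        (D (2 * k) + m * Q (2 * k)) - (tail D e T (2 * k) + m * weight Q e (2 * k) + c) -
          (x - m * y - c) := by ring
    rw [e1]
    exact dvd_sub (dvd_sub (dvd_err_even h (by omega)) h1) hC
  -- As x ≥ 0, the bound x-displacement < s + g reduces to tail(2k+1) < D(2k+1).
  · have := tail_succ_lt h he hT hk
    linarith

theorem dvd_corner (h : IsExpansion d m r A D Q) (hc : T + c = d) {k : ℕ} (hk : 2 * k + 2 ≤ r)
    (j : ℕ) : d ∣ (corner D Q e T k j).1 - m * (corner D Q e T k j).2 - c := by
  have h1 : d ∣ -tail D e T (2 * k + 1) + m * weight Q e (2 * k + 1) + c := by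
    simpa [pow_mul, pow_succ] using dvd_tail_add_weight (e := e) h hc (2 * k + 1) (by omega)
  have h2 : d ∣ D (2 * k + 2) + m * Q (2 * k + 2) := dvd_err_even h (k := k + 1) (by omega)
  have e1 : (corner D Q e T k j).1 - m * (corner D Q e T k j).2 - c =
      -(-tail D e T (2 * k + 1) + m * weight Q e (2 * k + 1) + c) -
        (D (2 * k + 2) + m * Q (2 * k + 2)) * j := by simp only [corner]; ring
  rw [e1]
  exact dvd_sub ((dvd_neg).2 h1) (h2.mul_right _)

/-- Within a block, a point that dominates no corner lies above all of them. -/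
theorem corner_snd_le (h : IsExpansion d m r A D Q) (he : IsAdmissible r A e)
    (hT : tail D e T r = 0) (hc : T + c = d) {k : ℕ} (hk : 2 * k + 2 ≤ r) {x y : ℤ}
    (hP : (x, y) ∈ cosetQuadrant d m c) (hy : weight Q e (2 * k + 1) ≤ y)
    (hno : ∀ j < e (2 * k + 2), ¬ corner D Q e T k j ≤ (x, y)) :
    ∀ j < e (2 * k + 2), (corner D Q e T k j).2 ≤ y := by
  have hC := hP.2.2
  have hx0 : 0 ≤ x := hP.1
  simp only at hC
  intro j
  induction j with
  | zero => intro _; simpa [corner] using hy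
  | succ j ih =>
    intro hj
    have h1 := ih (by omega)
    have h2 : x < (corner D Q e T k j).1 := by
      by_contra! hle
      exact hno j (by omega) ⟨hle, h1⟩
    have hD1 := h.err_pos (2 * k + 1) (by omega)
    have hD2 := h.err_pos (2 * k + 2) (by omega)
    -- Consecutive corners of a block differ by (-D(2k+2), Q(2k+2)), completed to a basis by
    -- (D(2k+1), Q(2k+1)).
    have key := le_of_lattice_vector (d := d) (m := m) (s := D (2 * k + 2)) (t := Q (2 * k + 2))
      (g := D (2 * k + 1)) (q := Q (2 * k + 1)) (x := (corner D Q e T k j).1 - x)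
      (y := y - (corner D Q e T k j).2) h.pos (dvd_err_even h (k := k + 1) (by omega))
      (dvd_err_odd h (by omega)) (h.det (2 * k + 1) (by omega)) hD2
      (h.den_nonneg (by omega)) hD1 (h.den_pos (2 * k) (by omega)).2 ?_ (by linarith) ?_
      (by linarith)
    · simp only [corner] at key ⊢
      push_cast
      linarith
    · have e1 : (corner D Q e T k j).1 - x + m * (y - (corner D Q e T k j).2) =
          ((corner D Q e T k j).1 - m * (corner D Q e T k j).2 - c) - (x - m * y - c) := by ring
      rw [e1]
      exact dvd_sub (dvd_corner h hc hk j) hC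
    · have h3 := tail_lt h he hT (i := 2 * k + 1) (by omega)
      have h4 : 0 ≤ (j : ℤ) * D (2 * k + 2) := by positivity
      simp only [corner]
      linarith

theorem weight_eq_of_forall_eq_zero {i : ℕ} (h0 : ∀ l, i < l → e l = 0) (n : ℕ) :
    weight Q e (i + n) = weight Q e i := by
  induction n with
  | zero => rfl
  | succ n ih => rw [← add_assoc, weight_succ, ih, h0 (i + n + 1) (by omega)]; simp

/-- Induction over blocks, n bounding r - 2k. The invariant is that (x,y) lies strictly to the left
of the block end (D(2k) - tail(2k), weight(2k) - Q(2k)) and not below it; for k = 0 that end is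
(c,0). -/
theorem exists_corner_le_of_lt (h : IsExpansion d m r A D Q) (he : IsAdmissible r A e)
    (hT : tail D e T r = 0) (hc : T + c = d) {x y : ℤ} (hP : (x, y) ∈ cosetQuadrant d m c) :
    ∀ n k, 2 * k ≤ r → r ≤ 2 * k + n → x < D (2 * k) - tail D e T (2 * k) →
      weight Q e (2 * k) - Q (2 * k) ≤ y → ∃ P ∈ corners r D Q e T c, P ≤ (x, y) := by
  intro n
  induction n with
  | zero =>
    intro k hk hkr hx hy
    have hy' := weight_le_of_lt h he hT hc hk hP hx hy
    refine ⟨_, Or.inr (Or.inl rfl), hP.1, ?_⟩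
    rw [weight_succ, he.1 (2 * k + 1) (by simp; omega)] at hy'
    rw [show r = 2 * k by omega]
    simpa using hy'
  | succ n ih =>
    intro k hk hkr hx hy
    have hy' := weight_le_of_lt h he hT hc hk hP hx hy
    -- With no digits left, weight(2k+1) is already the height of the final point on the ordinate
    -- axis.
    by_cases h0 : ∀ l, 2 * k + 1 < l → e l = 0
    · refine ⟨_, Or.inr (Or.inl rfl), hP.1, ?_⟩
      simp only
      rcases hk.lt_or_eq with hlt | heq
      · obtain ⟨n, rfl⟩ : ∃ n, r = 2 * k + 1 + n := ⟨r - (2 * k + 1), by omega⟩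
        rwa [weight_eq_of_forall_eq_zero h0]
      · rw [weight_succ, he.1 (2 * k + 1) (by simp; omega)] at hy'
        rw [← heq]
        simpa using hy'
    · push Not at h0
      obtain ⟨l, hl, hel⟩ := h0
      have hlr := le_depth_of_digit_ne_zero he hel
      have hr1 := tail_succ D e T (2 * k)
      have hr2 := tail_succ D e T (2 * k + 1)
      have hw1 := weight_succ Q e (2 * k)
      have hw2 := weight_succ Q e (2 * k + 1)
      have hdr := h.err_rec (2 * k) (by omega)
      have hqr := h.den_rec (2 * k) (by omega)
      by_cases hz : e (2 * k + 2) = 0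
      -- A zero digit followed by a nonzero one forces a full digit before it; the block ends at 2k
      -- and 2k+2 then coincide.
      · have hA : e (2 * k + 1) = A (2 * k + 1) := by
          rcases (he.2 (2 * k + 2) (by simp; omega)).2 hz with h1 | h1
          · exact absurd (h1 l (by omega)) hel
          · exact h1.2
        simp only [add_assoc, one_add_one_eq_two] at hr2 hw2
        rw [hz] at hr2 hw2
        rw [hA] at hr1 hw1
        push_cast at hr2 hw2
        refine ih (k + 1) (by omega) (by omega) ?_ ?_
        · rw [mul_add, mul_one]; linarith
        · rw [mul_add, mul_one]; linarith
      · by_contra! hno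
        have hno' : ∀ j < e (2 * k + 2), ¬ corner D Q e T k j ≤ (x, y) := fun j hj =>
          hno _ (Or.inr (Or.inr ⟨k, j, hj, rfl⟩))
        -- The last corner, j = e(2k+2) - 1, is the next block end.
        obtain ⟨j, hj⟩ : ∃ j, e (2 * k + 2) = j + 1 := ⟨e (2 * k + 2) - 1, by omega⟩
        have hjl : j < e (2 * k + 2) := by omega
        have h1 := corner_snd_le h he hT hc (k := k) (by omega) hP hy' hno' j hjl
        have h2 : x < (corner D Q e T k j).1 := by
          by_contra! hle
          exact hno' j hjl ⟨hle, h1⟩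
        simp only [add_assoc, one_add_one_eq_two] at hr2 hw2
        rw [hj] at hr2 hw2
        push_cast at hr2 hw2
        simp only [corner] at h1 h2
        obtain ⟨P, hP1, hP2⟩ := ih (k + 1) (by omega) (by omega)
          (by rw [mul_add, mul_one]; linarith) (by rw [mul_add, mul_one]; linarith)
        exact hno P hP1 hP2

/-- Every point of the coset in the first quadrant dominates a corner. -/
theorem exists_corner_le (h : IsExpansion d m r A D Q) (he : IsAdmissible r A e)
    (hT : tail D e T r = 0) (hc : T + c = d) {P : ℤ × ℤ} (hP : P ∈ cosetQuadrant d m c) :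
    ∃ P' ∈ corners r D Q e T c, P' ≤ P := by
  obtain ⟨x, y⟩ := P
  by_cases hx : c ≤ x
  · exact ⟨_, Or.inl rfl, hx, hP.2.1⟩
  · refine exists_corner_le_of_lt h he hT hc hP r 0 (by omega) (by omega) ?_ ?_
    · simp only [mul_zero, tail_zero, h.err_zero]; omega
    · simp only [mul_zero, weight_zero, h.den_zero]; exact hP.2.1

theorem weight_mono (h : IsExpansion d m r A D Q) {i n : ℕ} (hin : i + n ≤ r) :
    weight Q e i ≤ weight Q e (i + n) := by
  induction n with
  | zero => rfl
  | succ n ih =>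
    rw [← add_assoc, weight_succ]
    have := h.den_nonneg (k := i + n + 1) (by omega)
    have h1 : 0 ≤ (e (i + n + 1) : ℤ) * Q (i + n + 1) := by positivity
    linarith [ih (by omega)]

/-- From 2l to 2l+2 the abscissa drops by (A(2l+1) - e(2l+1)) D(2l+1) + e(2l+2) D(2l+2). -/
theorem blockEnd_antitone (h : IsExpansion d m r A D Q) (he : IsAdmissible r A e) {k n : ℕ}
    (hk : 2 * (k + n) ≤ r) : D (2 * (k + n)) - tail D e T (2 * (k + n)) ≤
      D (2 * k) - tail D e T (2 * k) := by
  induction n with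
  | zero => rfl
  | succ n ih =>
    refine le_trans ?_ (ih (by omega))
    generalize hl : k + n = l at *
    rw [← add_assoc, hl, mul_add, mul_one]
    have hr1 := tail_succ D e T (2 * l)
    have hr2 := tail_succ D e T (2 * l + 1)
    simp only [add_assoc, one_add_one_eq_two] at hr2
    have hdr := h.err_rec (2 * l) (by omega)
    have h1 : (e (2 * l + 1) : ℤ) * D (2 * l + 1) ≤ A (2 * l + 1) * D (2 * l + 1) :=
      mul_le_mul_of_nonneg_right (by exact_mod_cast digit_le he (i := 2 * l) (by omega))
        (h.err_pos _ (by omega)).le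
    have h2 : 0 ≤ (e (2 * l + 2) : ℤ) * D (2 * l + 2) :=
      mul_nonneg (by positivity) (h.err_pos _ (by omega)).le
    linarith

theorem corner_fst_lt (h : IsExpansion d m r A D Q) (he : IsAdmissible r A e) {k : ℕ}
    (hk : 2 * k + 2 ≤ r) (j : ℕ) :
    (corner D Q e T k j).1 < D (2 * k) - tail D e T (2 * k) := by
  have hr1 := tail_succ D e T (2 * k)
  have h1 := digit_mul_err_lt h he (i := 2 * k) (by omega)
  have h2 : 0 ≤ (j : ℤ) * D (2 * k + 2) := mul_nonneg (by positivity) (h.err_pos _ (by omega)).le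
  simp only [corner]
  linarith

theorem le_corner_fst (h : IsExpansion d m r A D Q) {k j : ℕ}
    (hk : 2 * k + 2 ≤ r) (hj : j < e (2 * k + 2)) :
    D (2 * (k + 1)) - tail D e T (2 * (k + 1)) ≤ (corner D Q e T k j).1 := by
  rw [mul_add, mul_one]
  have hr2 := tail_succ D e T (2 * k + 1)
  simp only [add_assoc, one_add_one_eq_two] at hr2
  have h2 : (j + 1 : ℤ) * D (2 * k + 2) ≤ e (2 * k + 2) * D (2 * k + 2) :=
    mul_le_mul_of_nonneg_right (by exact_mod_cast hj) (h.err_pos _ (by omega)).le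
  simp only [corner]
  linarith

theorem corner_fst_pos (h : IsExpansion d m r A D Q) (he : IsAdmissible r A e)
    (hT : tail D e T r = 0) {k j : ℕ} (hk : 2 * k + 2 ≤ r) (hj : j < e (2 * k + 2)) :
    0 < (corner D Q e T k j).1 := by
  have h1 := le_corner_fst (T := T) h hk hj
  have h2 := tail_lt h he hT (i := 2 * (k + 1)) (by omega)
  linarith

theorem corner_snd_lt (h : IsExpansion d m r A D Q) {k j : ℕ}
    (hk : 2 * k + 2 ≤ r) (hj : j < e (2 * k + 2)) :
    (corner D Q e T k j).2 < weight Q e (2 * k + 2) := by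
  have hw := weight_succ Q e (2 * k + 1)
  simp only [add_assoc, one_add_one_eq_two] at hw
  have hQ := (h.den_pos (2 * k + 1) (by omega)).2
  have h2 : (j + 1 : ℤ) * Q (2 * k + 2) ≤ e (2 * k + 2) * Q (2 * k + 2) :=
    mul_le_mul_of_nonneg_right (by exact_mod_cast hj) hQ.le
  simp only [add_assoc, one_add_one_eq_two] at hQ
  simp only [corner]
  linarith

theorem le_corner_snd (h : IsExpansion d m r A D Q) {k : ℕ} (hk : 2 * k + 2 ≤ r) (j : ℕ) :
    weight Q e (2 * k + 1) ≤ (corner D Q e T k j).2 := by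
  have h2 : 0 ≤ (j : ℤ) * Q (2 * k + 2) := mul_nonneg (by positivity) (h.den_nonneg (by omega))
  simp only [corner]
  linarith

/-- Admissibility allows a zero first digit only when all digits vanish, which would give T = 0. -/
theorem digit_one_pos (he : IsAdmissible r A e) (hT : tail D e T r = 0) (hT0 : 0 < T) :
    1 ≤ r ∧ 1 ≤ e 1 := by
  have hr : 1 ≤ r := by
    by_contra! hr
    rw [show r = 0 by omega, tail_zero] at hT
    omega
  refine ⟨hr, ?_⟩
  by_contra! h1
  rcases (he.2 1 (by simp; omega)).2 (by omega) with h2 | h2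
  · have := tail_eq_zero_of_forall_eq_zero hT r 0 (by omega) (fun l hl => h2 l (by omega))
    rw [tail_zero] at this
    omega
  · omega

theorem weight_one_pos (h : IsExpansion d m r A D Q) (he : IsAdmissible r A e)
    (hT : tail D e T r = 0) (hT0 : 0 < T) : 0 < weight Q e 1 := by
  have h1 := (digit_one_pos he hT hT0).2
  rw [weight_succ, weight_zero, zero_add, zero_add, h.den_one, mul_one]
  exact_mod_cast h1

theorem weight_pos (h : IsExpansion d m r A D Q) (he : IsAdmissible r A e)
    (hT : tail D e T r = 0) (hT0 : 0 < T) {i : ℕ} (hi : 1 ≤ i) (hir : i ≤ r) :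
    0 < weight Q e i := by
  have h1 := weight_one_pos h he hT hT0
  have h2 := weight_mono (e := e) h (i := 1) (n := i - 1) (by omega)
  rw [show 1 + (i - 1) = i by omega] at h2
  linarith

/-- Corners move strictly up and to the left. -/
theorem corner_strict (h : IsExpansion d m r A D Q) (he : IsAdmissible r A e)
    {k j k' j' : ℕ} (hj : j < e (2 * k + 2)) (hj' : j' < e (2 * k' + 2))
    (hlt : k < k' ∨ k = k' ∧ j < j') :
    (corner D Q e T k' j').1 < (corner D Q e T k j).1 ∧
      (corner D Q e T k j).2 < (corner D Q e T k' j').2 := by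
  have hk := le_depth_of_digit_ne_zero he (i := 2 * k + 2) (by omega)
  have hk' := le_depth_of_digit_ne_zero he (i := 2 * k' + 2) (by omega)
  rcases hlt with hlt | ⟨rfl, hlt⟩
  · constructor
    · have h1 := corner_fst_lt (T := T) h he hk' j'
      have h2 := le_corner_fst (T := T) h hk hj
      have h3 := blockEnd_antitone (T := T) h he (k := k + 1) (n := k' - (k + 1)) (by omega)
      rw [show k + 1 + (k' - (k + 1)) = k' by omega] at h3
      linarith
    · have h1 := corner_snd_lt (T := T) h hk hj
      have h2 := le_corner_snd (T := T) (e := e) h hk' j'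
      have h3 := weight_mono (e := e) h (i := 2 * k + 2) (n := 2 * k' + 1 - (2 * k + 2)) (by omega)
      rw [show 2 * k + 2 + (2 * k' + 1 - (2 * k + 2)) = 2 * k' + 1 by omega] at h3
      linarith
  · have hD := h.err_pos (2 * k + 2) (by omega)
    have hQ : 0 < Q (2 * k + 2) := (h.den_pos (2 * k + 1) (by omega)).2
    have hjj : (j : ℤ) < j' := by exact_mod_cast hlt
    have h1 := mul_lt_mul_of_pos_right hjj hD
    have h2 := mul_lt_mul_of_pos_right hjj hQ
    simp only [corner]
    constructor <;> linarith

theorem corner_lt_init (h : IsExpansion d m r A D Q) (he : IsAdmissible r A e)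
    (hT : tail D e T r = 0) (hT0 : 0 < T) (hc : T + c = d) {k j : ℕ} (hj : j < e (2 * k + 2)) :
    (corner D Q e T k j).1 < c ∧ 0 < (corner D Q e T k j).2 := by
  have hk := le_depth_of_digit_ne_zero he (i := 2 * k + 2) (by omega)
  have h1 := corner_fst_lt (T := T) h he hk j
  have h2 := blockEnd_antitone (T := T) h he (k := 0) (n := k) (by omega)
  have h3 := le_corner_snd (T := T) (e := e) h hk j
  have h4 := weight_pos h he hT hT0 (i := 2 * k + 1) (by omega) (by omega)
  simp only [zero_add, mul_zero, tail_zero, h.err_zero] at h2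
  constructor <;> linarith

theorem corner_lt_final (h : IsExpansion d m r A D Q) (he : IsAdmissible r A e)
    (hT : tail D e T r = 0) {k j : ℕ} (hj : j < e (2 * k + 2)) :
    0 < (corner D Q e T k j).1 ∧ (corner D Q e T k j).2 < weight Q e r := by
  have hk := le_depth_of_digit_ne_zero he (i := 2 * k + 2) (by omega)
  have h1 := corner_snd_lt (T := T) h hk hj
  have h2 := weight_mono (e := e) h (i := 2 * k + 2) (n := r - (2 * k + 2)) (by omega)
  rw [show 2 * k + 2 + (r - (2 * k + 2)) = r by omega] at h2
  exact ⟨corner_fst_pos h he hT hk hj, by linarith⟩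

theorem corners_subset (h : IsExpansion d m r A D Q) (he : IsAdmissible r A e)
    (hT : tail D e T r = 0) (hT0 : 0 < T) (hc0 : 0 < c) (hc : T + c = d) :
    corners r D Q e T c ⊆ cosetQuadrant d m c := by
  rintro P (rfl | rfl | ⟨k, j, hj, rfl⟩)
  · exact ⟨hc0.le, le_rfl, by simp⟩
  · have hr := (digit_one_pos he hT hT0).1
    refine ⟨le_rfl, (weight_pos h he hT hT0 hr le_rfl).le, ?_⟩
    have := dvd_tail_add_weight (e := e) h hc r (by omega)
    rw [hT, mul_zero, zero_add] at this
    rw [← dvd_neg]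
    simpa [add_comm, sub_eq_add_neg] using this
  · have hk := le_depth_of_digit_ne_zero he (i := 2 * k + 2) (by omega)
    exact ⟨(corner_lt_final h he hT hj).1.le, (corner_lt_init h he hT hT0 hc hj).2.le,
      dvd_corner h hc hk j⟩

theorem corners_antichain (h : IsExpansion d m r A D Q) (he : IsAdmissible r A e)
    (hT : tail D e T r = 0) (hT0 : 0 < T) (hc0 : 0 < c) (hc : T + c = d) {P P' : ℤ × ℤ}
    (hP : P ∈ corners r D Q e T c) (hP' : P' ∈ corners r D Q e T c) (hle : P ≤ P') : P = P' := by
  have hr := (digit_one_pos he hT hT0).1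
  have hw := weight_pos h he hT hT0 hr le_rfl
  obtain ⟨hle1, hle2⟩ := hle
  rcases hP with rfl | rfl | ⟨k, j, hj, rfl⟩ <;> rcases hP' with rfl | rfl | ⟨k', j', hj', rfl⟩
  · rfl
  · exact absurd hle1 (not_le.2 hc0)
  · exact absurd hle1 (not_le.2 (corner_lt_init h he hT hT0 hc hj').1)
  · exact absurd hle2 (not_le.2 hw)
  · rfl
  · exact absurd hle2 (not_le.2 (corner_lt_final h he hT hj').2)
  · exact absurd hle2 (not_le.2 (corner_lt_init h he hT hT0 hc hj).2)
  · exact absurd hle1 (not_le.2 (corner_lt_final h he hT hj).1)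
  · by_cases h1 : k < k' ∨ k = k' ∧ j < j'
    · exact absurd hle1 (not_le.2 (corner_strict h he hj hj' h1).1)
    by_cases h2 : k' < k ∨ k' = k ∧ j' < j
    · exact absurd hle2 (not_le.2 (corner_strict h he hj' hj h2).2)
    obtain rfl : k = k' := by omega
    obtain rfl : j = j' := by omega
    rfl

/-- The minimal points of the coset in the first quadrant are the corners. -/
theorem minimal_iff_mem_corners (h : IsExpansion d m r A D Q) (he : IsAdmissible r A e)
    (hT : tail D e T r = 0) (hT0 : 0 < T) (hc0 : 0 < c) (hc : T + c = d) (P : ℤ × ℤ) :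
    Minimal (· ∈ cosetQuadrant d m c) P ↔ P ∈ corners r D Q e T c := by
  have hsub := corners_subset h he hT hT0 hc0 hc
  constructor
  · intro hP
    obtain ⟨P', h1, h2⟩ := exists_corner_le h he hT hc hP.1
    rwa [le_antisymm (hP.2 (hsub h1) h2) h2]
  · intro hP
    refine ⟨hsub hP, fun P' h1 h2 => ?_⟩
    obtain ⟨P'', h3, h4⟩ := exists_corner_le h he hT hc h1
    rw [← corners_antichain h he hT hT0 hc0 hc h3 hP (h4.trans h2)]
    exact h4

/-- The number of corners. -/
theorem ncard_corners (h : IsExpansion d m r A D Q) (he : IsAdmissible r A e)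
    (hT : tail D e T r = 0) (hT0 : 0 < T) (hc0 : 0 < c) (hc : T + c = d) :
    (corners r D Q e T c).ncard = 2 + ∑ k ∈ Finset.Icc 1 (r / 2), e (2 * k) := by
  classical
  -- Digits vanish beyond r, so restricting k to the range r/2 loses no corner.
  set I : Finset (Σ _ : ℕ, ℕ) := (Finset.range (r / 2)).sigma fun k => Finset.range (e (2 * k + 2))
    with hI
  have hmem : ∀ x : Σ _ : ℕ, ℕ, x ∈ I ↔ x.2 < e (2 * x.1 + 2) := by
    intro x
    simp only [hI, Finset.mem_sigma, Finset.mem_range, and_iff_right_iff_imp]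
    intro hx
    have := le_depth_of_digit_ne_zero he (i := 2 * x.1 + 2) (by omega)
    omega
  have hcoe : corners r D Q e T c = ↑(insert (c, 0) (insert (0, weight Q e r)
      (I.image fun x => corner D Q e T x.1 x.2))) := by
    ext P
    simp only [corners, Finset.coe_insert, Finset.coe_image, Set.mem_insert_iff, Set.mem_image,
      SetLike.mem_coe, hmem]
    refine or_congr_right (or_congr_right ⟨?_, ?_⟩)
    · rintro ⟨k, j, hj, rfl⟩
      exact ⟨⟨k, j⟩, hj, rfl⟩
    · rintro ⟨x, hx, rfl⟩
      exact ⟨x.1, x.2, hx, rfl⟩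
  have hinj : Set.InjOn (fun x : Σ _ : ℕ, ℕ => corner D Q e T x.1 x.2) I := by
    rintro ⟨k, j⟩ hx ⟨k', j'⟩ hx' heq
    rw [SetLike.mem_coe, hmem] at hx hx'
    simp only at hx hx' heq
    have h1 : ¬ (k < k' ∨ k = k' ∧ j < j') := fun hlt => by
      have := (corner_strict (T := T) h he hx hx' hlt).1
      rw [heq] at this
      exact lt_irrefl _ this
    have h2 : ¬ (k' < k ∨ k' = k ∧ j' < j) := fun hlt => by
      have := (corner_strict (T := T) h he hx' hx hlt).1
      rw [heq] at this
      exact lt_irrefl _ this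
    obtain rfl : k = k' := by omega
    obtain rfl : j = j' := by omega
    rfl
  rw [hcoe, Set.ncard_coe_finset, Finset.card_insert_of_notMem, Finset.card_insert_of_notMem,
    Finset.card_image_of_injOn hinj, hI, Finset.card_sigma]
  · simp only [Finset.card_range]
    have : ∑ k ∈ Finset.Icc 1 (r / 2), e (2 * k) = ∑ k ∈ Finset.range (r / 2), e (2 * k + 2) := by
      rw [Finset.sum_bij (fun k _ => k - 1)]
      · intro k hk; simp at hk ⊢; omega
      · intro k hk l hl; simp at hk hl; omega
      · intro k hk; exact ⟨k + 1, by simp at hk ⊢; omega, by simp⟩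
      · intro k hk
        simp at hk
        rw [show 2 * (k - 1) + 2 = 2 * k by omega]
    rw [this]
    omega
  · simp only [Finset.mem_image, hmem, not_exists, not_and]
    intro x hx heq
    have := (corner_lt_final h he hT hx).1
    rw [heq] at this
    exact lt_irrefl _ this
  · simp only [Finset.mem_insert, Finset.mem_image, hmem, not_or, not_exists, not_and]
    refine ⟨fun heq => hc0.ne' (Prod.ext_iff.1 heq).1, fun x hx heq => ?_⟩
    have := (corner_lt_init h he hT hT0 hc hx).1
    rw [heq] at this
    exact lt_irrefl _ this

end Corners

end QuotientSemigroup

/-! ### The continued fraction of m/d satisfies the abstract axioms. -/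

namespace QuotientSemigroup

theorem fract_iterate_stepF_fract (x : ℚ) (k : ℕ) :
    Int.fract (stepF^[k] (Int.fract x)) = Int.fract (stepF^[k] x) := by
  rcases k with _ | k
  · simp
  · simp only [Function.iterate_succ_apply, stepF, Int.fract_fract]

theorem fract_div_self {d m : ℕ} (hmd : m < d) : Int.fract ((m : ℚ) / d) = m / d := by
  have hd0 : (0 : ℚ) < d := by exact_mod_cast (Nat.zero_le m).trans_lt hmd
  exact Int.fract_eq_self.2 ⟨by positivity, (div_lt_one hd0).2 (by exact_mod_cast hmd)⟩

/-- Euclid's algorithm: F sends m/d to d/m, whose fractional part is (d mod m)/m. -/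
theorem exists_fract_iterate_stepF_eq_zero (d : ℕ) :
    ∀ m : ℕ, m < d → ∃ k, Int.fract (stepF^[k] ((m : ℚ) / d)) = 0 := by
  induction d using Nat.strong_induction_on with
  | _ d ih =>
    intro m hm
    rcases Nat.eq_zero_or_pos m with rfl | hm0
    · exact ⟨0, by simp⟩
    · obtain ⟨k, hk⟩ := ih m hm (d % m) (Nat.mod_lt _ hm0)
      refine ⟨k + 1, ?_⟩
      have h2 : Int.fract ((d : ℚ) / m) = ((d % m : ℕ) : ℚ) / m :=
        Int.fract_div_natCast_eq_div_natCast_mod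
      rw [Function.iterate_succ_apply, stepF, fract_div_self hm, inv_div, ← fract_iterate_stepF_fract, h2]
      exact hk

/-- Numerators of the convergents, with indices shifted by one. -/
noncomputable def shiftNum (α : ℚ) : ℕ → ℤ
  | 0 => 1
  | k + 1 => convNum α k

/-- Denominators of the convergents, with indices shifted by one. -/
noncomputable def shiftDen (α : ℚ) : ℕ → ℤ
  | 0 => 0
  | k + 1 => convDen α k

/-- The numbers `d δ_{k-1}` for `α = m / d`. -/
noncomputable def scaledErr (d m : ℕ) (k : ℕ) : ℤ :=
  (-1) ^ (k + 1) * (shiftDen ((m : ℚ) / d) k * m - shiftNum ((m : ℚ) / d) k * d)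

theorem shiftDen_rec (α : ℚ) (k : ℕ) :
    shiftDen α (k + 2) = quot α (k + 1) * shiftDen α (k + 1) + shiftDen α k := by
  rcases k with _ | k <;> simp [shiftDen, convDen]

theorem shiftNum_rec (α : ℚ) (k : ℕ) :
    shiftNum α (k + 2) = quot α (k + 1) * shiftNum α (k + 1) + shiftNum α k := by
  rcases k with _ | k <;> simp [shiftNum, convNum]

theorem scaledErr_rec (d m k : ℕ) : scaledErr d m k =
    quot ((m : ℚ) / d) (k + 1) * scaledErr d m (k + 1) + scaledErr d m (k + 2) := by
  simp only [scaledErr, shiftDen_rec, shiftNum_rec, pow_succ]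
  ring

section Expansion

variable {d m : ℕ}

theorem fract_iterate_depth (hmd : m < d) :
    Int.fract (stepF^[depth ((m : ℚ) / d)] ((m : ℚ) / d)) = 0 :=
  Nat.sInf_mem (s := {k : ℕ | Int.fract (stepF^[k] ((m : ℚ) / d)) = 0})
    (exists_fract_iterate_stepF_eq_zero d m hmd)

theorem fract_iterate_pos {α : ℚ} {k : ℕ} (hk : k < depth α) :
    0 < Int.fract (stepF^[k] α) :=
  lt_of_le_of_ne (Int.fract_nonneg _) (Ne.symm (Nat.notMem_of_lt_sInf hk))

theorem one_lt_iterate {α : ℚ} {k : ℕ} (hk : k < depth α) : 1 < stepF^[k + 1] α := by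
  rw [Function.iterate_succ_apply', stepF]
  exact (one_lt_inv₀ (fract_iterate_pos hk)).2 (Int.fract_lt_one _)

theorem depth_pos (hm : 0 < m) (hmd : m < d) : 0 < depth ((m : ℚ) / d) := by
  rw [Nat.pos_iff_ne_zero]
  intro h0
  have h1 := fract_iterate_depth hmd
  rw [h0, Function.iterate_zero, id, fract_div_self hmd] at h1
  have hd0 : (0 : ℚ) < d := by exact_mod_cast hm.trans hmd
  have hm0 : (0 : ℚ) < m := by exact_mod_cast hm
  exact (div_pos hm0 hd0).ne' h1

theorem quot_zero (hm : 0 < m) (hmd : m < d) : quot ((m : ℚ) / d) 0 = 0 := by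
  have hd0 : (0 : ℚ) < d := by exact_mod_cast hm.trans hmd
  rw [quot, if_pos (depth_pos hm hmd), Function.iterate_zero, id, Nat.floor_eq_zero]
  exact (div_lt_one hd0).2 (by exact_mod_cast hmd)

theorem scaledErr_zero (d m : ℕ) : scaledErr d m 0 = d := by simp [scaledErr, shiftDen, shiftNum]

theorem scaledErr_one (hm : 0 < m) (hmd : m < d) : scaledErr d m 1 = m := by
  simp [scaledErr, shiftDen, shiftNum, convDen, convNum, quot_zero hm hmd]

/-- The iterates of F are ratios of consecutive errors; a nonzero fractional part before the depth
keeps the next error positive. -/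
theorem scaledErr_pos_and_iterate (hm : 0 < m) (hmd : m < d) :
    ∀ k < depth ((m : ℚ) / d), 0 < scaledErr d m (k + 1) ∧
      stepF^[k + 1] ((m : ℚ) / d) = (scaledErr d m k : ℚ) / scaledErr d m (k + 1) := by
  intro k
  induction k with
  | zero =>
    intro _
    rw [scaledErr_one hm hmd, scaledErr_zero, Function.iterate_succ_apply, Function.iterate_zero,
      id, stepF, fract_div_self hmd, inv_div]
    exact ⟨by exact_mod_cast hm, by push_cast; rfl⟩
  | succ k ih =>
    intro hk
    obtain ⟨h1, h2⟩ := ih (by omega)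
    have h1' : (0 : ℚ) < scaledErr d m (k + 1) := by exact_mod_cast h1
    have hpos := fract_iterate_pos hk
    have hq : quot ((m : ℚ) / d) (k + 1) = ⌊stepF^[k + 1] ((m : ℚ) / d)⌋₊ := by
      rw [quot, if_pos hk]
    have hrec : (scaledErr d m k : ℚ) = quot ((m : ℚ) / d) (k + 1) * scaledErr d m (k + 1) +
        scaledErr d m (k + 2) := by exact_mod_cast scaledErr_rec d m k
    have hnn : 0 ≤ stepF^[k + 1] ((m : ℚ) / d) := by
      linarith [one_lt_iterate (α := (m : ℚ) / d) (k := k) (by omega)]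
    have hfl : Int.fract (stepF^[k + 1] ((m : ℚ) / d)) =
        (scaledErr d m (k + 2) : ℚ) / scaledErr d m (k + 1) := by
      rw [Int.fract, ← natCast_floor_eq_intCast_floor hnn, ← hq, h2, hrec]
      field_simp
      ring
    constructor
    · rw [hfl] at hpos
      have := (div_pos_iff_of_pos_right h1').1 hpos
      exact_mod_cast this
    · rw [Function.iterate_succ_apply', stepF, hfl, inv_div]

/-- At the depth r, F^r(α) is an integer n ≥ 2, so D(r-1) = n D(r); the stored quotient is n - 1,
and the recurrence leaves D(r+1) = D(r). -/
theorem scaledErr_depth_succ (hm : 0 < m) (hmd : m < d) :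
    scaledErr d m (depth ((m : ℚ) / d) + 1) = scaledErr d m (depth ((m : ℚ) / d)) ∧
      1 ≤ quot ((m : ℚ) / d) (depth ((m : ℚ) / d)) := by
  have hf := fract_iterate_depth hmd
  obtain ⟨k, hk⟩ : ∃ k, depth ((m : ℚ) / d) = k + 1 :=
    ⟨_, (Nat.succ_pred_eq_of_pos (depth_pos hm hmd)).symm⟩
  obtain ⟨h1, h2⟩ := scaledErr_pos_and_iterate hm hmd k (by omega)
  have h3 := one_lt_iterate (α := (m : ℚ) / d) (k := k) (by omega)
  have hq : quot ((m : ℚ) / d) (k + 1) = ⌊stepF^[k + 1] ((m : ℚ) / d)⌋₊ - 1 := by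
    rw [quot, if_neg (by omega), if_pos hk.symm]
  rw [hk] at hf ⊢
  have h4 : (⌊stepF^[k + 1] ((m : ℚ) / d)⌋₊ : ℚ) = stepF^[k + 1] ((m : ℚ) / d) := by
    rw [natCast_floor_eq_intCast_floor (by linarith)]
    linarith [Int.floor_add_fract (stepF^[k + 1] ((m : ℚ) / d))]
  generalize ⌊stepF^[k + 1] ((m : ℚ) / d)⌋₊ = n at *
  have hn : 1 < n := by
    rw [← h4] at h3
    exact_mod_cast h3
  refine ⟨?_, by omega⟩
  have h1' : (scaledErr d m (k + 1) : ℚ) ≠ 0 := by exact_mod_cast h1.ne'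
  have h5 : (scaledErr d m k : ℚ) = n * scaledErr d m (k + 1) := by
    rw [h4, h2]; field_simp
  have h6 : scaledErr d m k = n * scaledErr d m (k + 1) := by exact_mod_cast h5
  have h7 := scaledErr_rec d m k
  rw [hq, h6] at h7
  push_cast [Nat.cast_sub hn.le] at h7
  linear_combination (-1 : ℤ) * h7

/-- Running the recurrence down to k = 0 makes D(r) a common divisor of d and m, hence a unit when
these are coprime. -/
theorem scaledErr_depth_dvd (hm : 0 < m) (hmd : m < d) : ∀ n k, k + n = depth ((m : ℚ) / d) →
    scaledErr d m (depth ((m : ℚ) / d)) ∣ scaledErr d m k ∧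
      scaledErr d m (depth ((m : ℚ) / d)) ∣ scaledErr d m (k + 1) := by
  intro n
  induction n with
  | zero =>
    intro k hk
    rw [← hk, add_zero, show k = depth ((m : ℚ) / d) by omega, (scaledErr_depth_succ hm hmd).1]
    simp
  | succ n ih =>
    intro k hk
    obtain ⟨h1, h2⟩ := ih (k + 1) (by omega)
    refine ⟨?_, h1⟩
    rw [scaledErr_rec d m k]
    exact dvd_add (h1.mul_left _) h2

theorem scaledErr_depth (hm : 0 < m) (hmd : m < d) (hcop : Nat.Coprime m d) :
    scaledErr d m (depth ((m : ℚ) / d)) = 1 := by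
  obtain ⟨h1, h2⟩ := scaledErr_depth_dvd hm hmd _ 0 (zero_add _)
  rw [scaledErr_zero] at h1
  rw [zero_add, scaledErr_one hm hmd] at h2
  have hu : IsUnit (scaledErr d m (depth ((m : ℚ) / d))) :=
    (Nat.isCoprime_iff_coprime.2 hcop).isUnit_of_dvd' h2 h1
  have hpos : 0 < scaledErr d m (depth ((m : ℚ) / d)) := by
    have hp := depth_pos hm hmd
    have := (scaledErr_pos_and_iterate hm hmd (depth ((m : ℚ) / d) - 1) (by omega)).1
    rwa [Nat.sub_add_cancel hp] at this
  rcases Int.isUnit_iff.1 hu with h | h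
  · exact h
  · omega

/-- The continued fraction expansion of `m / d`. -/
theorem isExpansion (hm : 0 < m) (hmd : m < d) (hcop : Nat.Coprime m d) :
    IsExpansion d m (depth ((m : ℚ) / d)) (quot ((m : ℚ) / d)) (scaledErr d m)
      (shiftDen ((m : ℚ) / d)) where
  quot_pos k hk := by
    rcases Nat.lt_or_ge (k + 1) (depth ((m : ℚ) / d)) with h | h
    · rw [quot, if_pos h, Nat.one_le_floor_iff]
      exact (one_lt_iterate hk).le
    · rw [show k + 1 = depth ((m : ℚ) / d) by omega]
      exact (scaledErr_depth_succ hm hmd).2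
  err_zero := scaledErr_zero d m
  err_one := scaledErr_one hm hmd
  err_rec k _ := scaledErr_rec d m k
  err_pos k hk := by
    rcases k with _ | k
    · rw [scaledErr_zero]; exact_mod_cast hm.trans hmd
    · rcases Nat.lt_or_ge k (depth ((m : ℚ) / d)) with h | h
      · exact (scaledErr_pos_and_iterate hm hmd k h).1
      · rw [show k = depth ((m : ℚ) / d) by omega, (scaledErr_depth_succ hm hmd).1,
          scaledErr_depth hm hmd hcop]
        exact one_pos
  err_depth := scaledErr_depth hm hmd hcop
  err_last := by rw [(scaledErr_depth_succ hm hmd).1, scaledErr_depth hm hmd hcop]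
  den_zero := rfl
  den_one := by simp [shiftDen, convDen]
  den_rec k _ := shiftDen_rec _ k

theorem delta_eq (hd : 0 < d) (i : ℕ) :
    delta ((m : ℚ) / d) i = (scaledErr d m (i + 1) : ℚ) / d := by
  have hd0 : (d : ℚ) ≠ 0 := by exact_mod_cast hd.ne'
  simp only [delta, scaledErr, shiftDen, shiftNum, pow_succ]
  push_cast
  field_simp

theorem isNumeration_iff (hd : 0 < d) (T : ℤ) (e : ℕ → ℕ) :
    IsNumeration ((m : ℚ) / d) ((T : ℚ) / d) e ↔
      IsAdmissible (depth ((m : ℚ) / d)) (quot ((m : ℚ) / d)) e ∧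
        tail (scaledErr d m) e T (depth ((m : ℚ) / d)) = 0 := by
  have hd0 : (d : ℚ) ≠ 0 := by exact_mod_cast hd.ne'
  refine and_congr Iff.rfl ?_
  rw [tail_depth_eq_zero_iff]
  have hsum : ∑ j ∈ Finset.Icc 1 (depth ((m : ℚ) / d)),
      (e j : ℚ) * ((-1) ^ (j - 1) * delta ((m : ℚ) / d) (j - 1)) =
      ((∑ l ∈ Finset.Icc 1 (depth ((m : ℚ) / d)),
        (-1) ^ (l - 1) * (e l * scaledErr d m l) : ℤ) : ℚ) / d := by
    push_cast
    rw [Finset.sum_div]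
    refine Finset.sum_congr rfl fun j hj => ?_
    rw [delta_eq hd, Nat.sub_add_cancel (Finset.mem_Icc.1 hj).1]
    ring
  rw [hsum, div_left_inj' hd0]
  norm_cast

theorem convDen_sub_one {α : ℚ} {i : ℕ} (hi : 1 ≤ i) :
    (convDen α (i - 1) : ℚ) = shiftDen α i := by
  obtain ⟨i, rfl⟩ : ∃ k, i = k + 1 := ⟨i - 1, by omega⟩
  simp [shiftDen]

theorem weight_shiftDen (α : ℚ) (e : ℕ → ℕ) (n : ℕ) :
    (weight (shiftDen α) e n : ℚ) =
      ∑ i ∈ Finset.Icc 1 n, (e i : ℚ) * (convDen α (i - 1) : ℚ) := by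
  rw [weight]
  push_cast
  refine Finset.sum_congr rfl fun i hi => ?_
  rw [convDen_sub_one (Finset.mem_Icc.1 hi).1]

/-- dμ_i is the value of au + bv on the lattice vector ((-1)^i D(i+1), Q(i+1)). -/
theorem mul_mu_eq (hd : 0 < d) (a b : ℚ) (i : ℕ) :
    (d : ℚ) * ((a * m + b) / d * (convDen ((m : ℚ) / d) i : ℚ) - a * convNum ((m : ℚ) / d) i) =
      a * ((-1) ^ i * scaledErr d m (i + 1)) + b * shiftDen ((m : ℚ) / d) (i + 1) := by
  have hd0 : (d : ℚ) ≠ 0 := by exact_mod_cast hd.ne'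
  have h : ((-1 : ℚ) ^ i) * (-1) ^ i = 1 := by rw [← mul_pow]; simp
  simp only [scaledErr, shiftDen, shiftNum, pow_succ]
  push_cast
  field_simp
  linear_combination (-(a * ((convDen ((m : ℚ) / d) i : ℚ) * m - convNum ((m : ℚ) / d) i * d))) * h

/-- The sum of the μ's evaluates au + bv along the walk; the term aT/d accounts for its start at
(-T,0). -/
theorem corner_value (hd : 0 < d) (a b f : ℚ) (e : ℕ → ℕ) (T : ℤ) {μ : ℕ → ℚ}
    (hμ : ∀ i, μ i = (a * m + b) / d * (convDen ((m : ℚ) / d) i : ℚ) -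
      a * convNum ((m : ℚ) / d) i) (k j : ℕ) :
    f / d + a * ((T : ℚ) / d) - j * μ (2 * k + 1) -
        ∑ i ∈ Finset.Icc 1 (2 * k + 1), (e i : ℚ) * μ (i - 1) =
      (f - (a * (corner (scaledErr d m) (shiftDen ((m : ℚ) / d)) e T k j).1 +
        b * (corner (scaledErr d m) (shiftDen ((m : ℚ) / d)) e T k j).2)) / d := by
  have hd0 : (d : ℚ) ≠ 0 := by exact_mod_cast hd.ne'
  have hμ' : ∀ i, (d : ℚ) * μ i =
      a * ((-1) ^ i * scaledErr d m (i + 1)) + b * shiftDen ((m : ℚ) / d) (i + 1) := fun i => by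
    rw [hμ, mul_mu_eq hd]
  have hsum : (d : ℚ) * ∑ i ∈ Finset.Icc 1 (2 * k + 1), (e i : ℚ) * μ (i - 1) =
      a * (T + tail (scaledErr d m) e T (2 * k + 1)) +
        b * weight (shiftDen ((m : ℚ) / d)) e (2 * k + 1) := by
    have h1 : (T : ℚ) + tail (scaledErr d m) e T (2 * k + 1) =
        ∑ l ∈ Finset.Icc 1 (2 * k + 1), (-1) ^ (l - 1) * (e l * (scaledErr d m l : ℚ)) := by
      simp only [tail, pow_succ, pow_mul]
      push_cast
      ring
    rw [h1, weight]
    push_cast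
    rw [Finset.mul_sum, Finset.mul_sum, Finset.mul_sum, ← Finset.sum_add_distrib]
    refine Finset.sum_congr rfl fun i hi => ?_
    have h2 := hμ' (i - 1)
    rw [Nat.sub_add_cancel (Finset.mem_Icc.1 hi).1] at h2
    linear_combination (e i : ℚ) * h2
  have h3 := hμ' (2 * k + 1)
  have hneg : (-1 : ℚ) ^ (2 * k + 1) = -1 := by simp [pow_succ, pow_mul]
  rw [hneg] at h3
  rw [eq_div_iff hd0, sub_mul, sub_mul, add_mul, div_mul_cancel₀ _ hd0]
  simp only [corner]
  push_cast
  have h4 : a * ((T : ℚ) / d) * d = a * T := by field_simp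
  rw [h4]
  linear_combination (-(j : ℚ)) * h3 - hsum

end Expansion

end QuotientSemigroup

/-! ### Assembly of the theorem. -/

open QuotientSemigroup in
theorem theorem7 (a b d : ℕ) (ha : 0 < a) (hb : 0 < b) (hd : 0 < d)
    (hab : Nat.Coprime a b) (had : Nat.Coprime a d) (hbd : Nat.Coprime b d)
    (hlt : d < min a b) (hndvd : ¬ ((d : ℤ) ∣ (a : ℤ) * b - a - b))
    (m : ℕ) (hm : m ∈ Finset.Icc 1 (d - 1)) (hmd : d ∣ a * m + b)
    (α β τ f : ℚ) (hα : α = (m : ℚ) / d)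
    (hβ : β = 1 - Int.fract (((b : ℚ) - 1 + m) / d))
    (hτ : τ = ((a : ℚ) * m + b) / d) (hf : f = (a : ℚ) * b - a - b)
    (r : ℕ) (hr : r = depth α)
    (μ : ℕ → ℚ) (hμ : ∀ i, μ i = τ * (convDen α i : ℚ) - a * (convNum α i : ℚ)) :
    (∃! e : ℕ → ℕ, IsNumeration α β e) ∧
    ∀ e : ℕ → ℕ, IsNumeration α β e →
      ∀ (B : Set ℕ), B = {i | i ∈ Finset.Icc 1 (r / 2) ∧ e (2 * i) ≠ 0} →
      ∀ (f₁ f₂ : ℚ), f₁ = f / d - a * (1 - β) →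
        f₂ = f / d - (b : ℚ) / d * ∑ i ∈ Finset.Icc 1 r, (e i : ℚ) * (convDen α (i - 1) : ℚ) →
      (fun x : ℤ => (x : ℚ)) '' PF (quotient (gen a b) d) =
          {f₁, f₂} ∪
          {x : ℚ | ∃ k ∈ B, ∃ j : ℕ, j < e (2 * k) ∧
            x = f / d + a * β - j * μ (2 * k - 1)
              - ∑ i ∈ Finset.Icc 1 (2 * k - 1), (e i : ℚ) * μ (i - 1)} ∧
      type (quotient (gen a b) d) = 2 + ∑ k ∈ Finset.Icc 1 (r / 2), e (2 * k) := by
  obtain ⟨hm1, hm2⟩ := Finset.mem_Icc.1 hm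
  have hmltd : m < d := by omega
  obtain ⟨hda, hdb⟩ := lt_min_iff.1 hlt
  have hd0 : (d : ℚ) ≠ 0 := by exact_mod_cast hd.ne'
  have hdZ : (0 : ℤ) < d := by exact_mod_cast hd
  have hmdZ : (d : ℤ) ∣ a * m + b := by exact_mod_cast hmd
  have hcop : Nat.Coprime m d := by
    refine Nat.Coprime.symm (Nat.coprime_of_dvd fun p hp hpd hpm => ?_)
    have h1 : p ∣ b := (Nat.dvd_add_right (hpm.mul_left a)).1 (hpd.trans hmd)
    exact hp.one_lt.ne' (Nat.dvd_one.1 (hbd ▸ Nat.dvd_gcd h1 hpd))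
  -- Since am ≡ -b (mod d), a(b - 1 + m) ≡ ab - a - b, so c solves ac ≡ f.
  set c : ℤ := ((b : ℤ) - 1 + m) % d with hc
  have hcf : (d : ℤ) ∣ a * c - (a * b - a - b) := by
    have h1 : (d : ℤ) ∣ ((b : ℤ) - 1 + m) - c := Int.dvd_self_sub_emod
    have e1 : (a : ℤ) * c - (a * b - a - b) = (a * m + b) - a * (((b : ℤ) - 1 + m) - c) := by ring
    rw [e1]
    exact dvd_sub hmdZ (h1.mul_left _)
  -- If c = 0, then d divides f and the origin would be the only minimal point.
  have hc0 : 0 < c := by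
    refine lt_of_le_of_ne (Int.emod_nonneg _ hdZ.ne') fun h0 => hndvd ?_
    rw [← h0, mul_zero, zero_sub, dvd_neg] at hcf
    exact hcf
  have hcd : c < d := Int.emod_lt_of_pos _ hdZ
  set T : ℤ := d - c with hTdef
  have hTc : T + c = d := by rw [hTdef]; ring
  have hT0 : 0 < T := by omega
  have hfr : Int.fract (((b : ℚ) - 1 + m) / d) = (c : ℚ) / d := by
    have h1 := Int.fract_div_intCast_eq_div_intCast_mod (k := ℚ) (m := (b : ℤ) - 1 + m) (n := d)
    push_cast at h1
    rw [h1, hc]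
  have hβT : β = (T : ℚ) / d := by
    rw [hβ, hfr, hTdef]
    push_cast
    field_simp
  have h := isExpansion hm1 hmltd hcop
  subst hα hr
  rw [hβT]
  constructor
  · obtain ⟨e, he, hT⟩ := exists_digits h hT0.le (show T < d by omega)
    refine ⟨e, (isNumeration_iff hd T e).2 ⟨he, hT⟩, fun e' he' => ?_⟩
    obtain ⟨he', hT'⟩ := (isNumeration_iff hd T e').1 he'
    exact digits_unique h he' hT' he hT
  · rintro e hnum B rfl f₁ f₂ hf₁ hf₂
    obtain ⟨he, hT⟩ := (isNumeration_iff hd T e).1 hnum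
    have hmin := minimal_iff_mem_corners h he hT hT0 hc0 hTc
    have hPF := mem_PF_iff ha hb hd hab had hda hdb hmdZ hcf
    simp only [hmin] at hPF
    have hdvd : ∀ P ∈ corners (depth ((m : ℚ) / d)) (scaledErr d m) (shiftDen ((m : ℚ) / d)) e T c,
        ∃ x : ℤ, (d : ℤ) * x = (a * b - a - b) - (a * P.1 + b * P.2) := by
      intro P hP
      obtain ⟨x, hx⟩ := (dvd_comb_iff (Nat.isCoprime_iff_coprime.2 had) hmdZ hcf P.1 P.2).2
        (corners_subset h he hT hT0 hc0 hTc hP).2.2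
      exact ⟨x, hx.symm⟩
    have himage : ∀ x : ℚ, x ∈ (fun x : ℤ => (x : ℚ)) '' PF (quotient (gen a b) d) ↔
        ∃ P ∈ corners (depth ((m : ℚ) / d)) (scaledErr d m) (shiftDen ((m : ℚ) / d)) e T c,
          x = (f - (a * P.1 + b * P.2)) / d := by
      intro x
      have hcast : ∀ (z : ℤ) (P : ℤ × ℤ), (d : ℤ) * z = (a * b - a - b) - (a * P.1 + b * P.2) →
          (z : ℚ) = (f - (a * P.1 + b * P.2)) / d := by
        intro z P hz
        rw [eq_div_iff hd0, hf, mul_comm]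
        exact_mod_cast hz
      constructor
      · rintro ⟨z, hz, rfl⟩
        obtain ⟨P, hP, hz⟩ := (hPF z).1 hz
        exact ⟨P, hP, hcast z P hz⟩
      · rintro ⟨P, hP, rfl⟩
        obtain ⟨z, hz⟩ := hdvd P hP
        exact ⟨z, (hPF z).2 ⟨P, hP, hz⟩, hcast z P hz⟩
    have hcv := corner_value hd (a : ℚ) b f e T (μ := μ) (fun i => by rw [hμ, hτ])
    constructor
    · ext x
      rw [himage]
      -- f₁ comes from the corner (c,0), as 1 - β = c/d; f₂ comes from the corner on the ordinate
      -- axis.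
      have e1 : f₁ = (f - (a * (c : ℚ) + b * ((0 : ℤ) : ℚ))) / d := by
        rw [hf₁, ← hβT, hβ, hfr]
        push_cast
        field_simp
        ring
      have e2 : f₂ = (f - (a * ((0 : ℤ) : ℚ) +
          b * (weight (shiftDen ((m : ℚ) / d)) e (depth ((m : ℚ) / d)) : ℚ))) / d := by
        rw [hf₂, weight_shiftDen]
        push_cast
        ring
      constructor
      · rintro ⟨P, rfl | rfl | ⟨k, j, hj, rfl⟩, rfl⟩
        · exact Or.inl (Or.inl e1.symm)
        · exact Or.inl (Or.inr e2.symm)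
        · have hk := le_depth_of_digit_ne_zero he (i := 2 * k + 2) (by omega)
          refine Or.inr ⟨k + 1, ⟨Finset.mem_Icc.2 ⟨by omega, by omega⟩, ?_⟩, j, hj, ?_⟩
          · rw [mul_add, mul_one]; omega
          · rw [show 2 * (k + 1) - 1 = 2 * k + 1 by omega, hcv]
      · rintro ((rfl | rfl) | ⟨k, ⟨hk, -⟩, j, hj, rfl⟩)
        · exact ⟨_, Or.inl rfl, e1⟩
        · exact ⟨_, Or.inr (Or.inl rfl), e2⟩
        · obtain ⟨k, rfl⟩ : ∃ l, k = l + 1 := ⟨k - 1, by simp at hk; omega⟩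
          refine ⟨_, Or.inr (Or.inr ⟨k, j, hj, rfl⟩), ?_⟩
          rw [show 2 * (k + 1) - 1 = 2 * k + 1 by omega, hcv]
    · rw [← ncard_corners h he hT hT0 hc0 hTc, type]
      choose! g hg using hdvd
      have hPFg : PF (quotient (gen a b) d) = g '' corners (depth ((m : ℚ) / d)) (scaledErr d m)
          (shiftDen ((m : ℚ) / d)) e T c := by
        ext x
        rw [hPF]
        constructor
        · rintro ⟨P, hP, hx⟩
          exact ⟨P, hP, mul_left_cancel₀ hdZ.ne' ((hg P hP).trans hx.symm)⟩
        · rintro ⟨P, hP, rfl⟩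
          exact ⟨P, hP, hg P hP⟩
      rw [hPFg]
      -- Distinct corners give distinct numbers, their coordinates being below d < min(a,b).
      refine Set.InjOn.ncard_image fun P hP P' hP' heq => ?_
      have h1 := hg P hP
      have h2 := hg P' hP'
      have h3 := minimal_lt hdZ ((hmin P).2 hP)
      have h4 := corners_subset h he hT hT0 hc0 hTc hP'
      have hda' : (d : ℤ) < a := by exact_mod_cast hda
      have hdb' : (d : ℤ) < b := by exact_mod_cast hdb
      obtain ⟨h5, h6⟩ := comb_unique (by exact_mod_cast ha) (by exact_mod_cast hb)
        (Nat.isCoprime_iff_coprime.2 hab) (h3.1.trans hdb') (h3.2.trans hda') h4.1 h4.2.1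
        (by rw [heq] at h1; linarith)
      exact Prod.ext h5 h6
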